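/- Let $\mathbb{R}^2_+=\{x=(x_1,x_2): x_2>0\}$, let $y^*=(y_1,-y_2)$ and $\nabla^\perp=(\partial_2,-\partial_1)$, and set $$E(x)=-\frac1{2\pi}\log|x|,\qquad D(x,y)=E(x-y)-E(x-y^*),\qquad \Gamma(x,t)=\frac1{4\pi t}e^{-|x|^2/4t}.$$ For a finite real Borel measure $\omega_0$ on the closed half plane $\overline{\mathbb{R}^2_+}$ let $K\omega_0$ be the velocity field given by the Biot–Savart law $$K\omega_0(x)=\int_{\overline{\mathbb{R}^2_+}}\nabla^\perp_xD(x,y)\,\omega_0(dy).$$ Let $S(t)$, $t>0$, be the Stokes semigroup on $\mathbb{R}^2_+$ with the no-slip boundary condition, $$S(t)u(x)=\int_{\mathbb{R}^2_+}G(x,z,t)u(z)\,dz,$$ where $G=(G_{ij})_{1\le i,j\le2}$ is the Green matrix $$G_{ij}(x,z,t)=\big(\Gamma(x-z,t)-\Gamma(x-z^*,t)\big)\delta_{ij}-4(1-\delta_{j2})\,\partial_{x_j}\int_0^{x_2}\!\!\int_{\mathbb{R}}\partial_{x_i}E(x-w)\,\Gamma(w-z^*,t)\,dw_1dw_2 .$$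 Let $T(t)\omega_0=-\nabla^\perp\cdot S(t)K\omega_0=\partial_1(S(t)K\omega_0)^2-\partial_2(S(t)K\omega_0)^1$ be the vorticity of the Stokes flow with initial vorticity $\omega_0$. **Theorem 4.7.** For every finite real Borel measure $\omega_0$ on $\overline{\mathbb{R}^2_+}$ the following holds. The vorticity $T(t)\omega_0$ is well defined for all $t>0$: the integral $K\omega_0(x)$ converges absolutely for almost every $x\in\mathbb{R}^2_+$; the integrals $\int_{\mathbb{R}^2_+}G_{ij}(x,z,t)(K\omega_0)^j(z)\,dz$ converge absolutely for all $x\in\mathbb{R}^2_+$ and $t>0$; and the classical derivatives $\partial_2(S(t)K\omega_0)^1$ and $\partial_1(S(t)K\omega_0)^2$ exist at every point of $\mathbb{R}^2_+$. Moreover, for every $1\le q\le\infty$, $T(t)\omega_0\in L^q(\mathbb{R}^2_+)$ for all $t>0$, and $$\lim_{t\to\infty}t^{1-1/q}\,\|T(t)\omega_0\|_{L^q(\mathbb{R}^2_+)}=0 .$$ -/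

import Mathlib

open MeasureTheory Filter Topology
open scoped ENNReal

namespace HalfPlaneStokes

/-! Points of the plane are pairs `x = (x.1, x.2)` of real numbers, and the Euclidean norm is written
out. Components of vectors and matrices are indexed by `Fin 2`, so that the index `0` stands for
the tangential direction `x₁` and the index `1` for the normal direction `x₂`. -/

/-- The open half plane `x₂ > 0`. -/
def halfPlane : Set (ℝ × ℝ) := {x | 0 < x.2}

/-- The closed half plane `x₂ ≥ 0`. -/
def closedHalfPlane : Set (ℝ × ℝ) := {x | 0 ≤ x.2}

/-- The reflection `y* = (y₁, -y₂)`. -/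
def refl (y : ℝ × ℝ) : ℝ × ℝ := (y.1, -y.2)

/-- The classical partial derivative of `f` in the direction of the coordinate `j`. -/
noncomputable def pderiv (j : Fin 2) (f : ℝ × ℝ → ℝ) (x : ℝ × ℝ) : ℝ :=
  match j with
  | 0 => deriv (fun s => f (s, x.2)) x.1
  | 1 => deriv (fun s => f (x.1, s)) x.2

/-- The perpendicular gradient `∇^⊥ f = (∂₂ f, -∂₁ f)`. -/
noncomputable def gradPerp (f : ℝ × ℝ → ℝ) (x : ℝ × ℝ) : Fin 2 → ℝ :=
  ![pderiv 1 f x, -pderiv 0 f x]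

/-- The perpendicular divergence `∇^⊥ · u = ∂₂ u¹ - ∂₁ u²` of a vector field. -/
noncomputable def divPerp (u : ℝ × ℝ → Fin 2 → ℝ) (x : ℝ × ℝ) : ℝ :=
  pderiv 1 (fun z => u z 0) x - pderiv 0 (fun z => u z 1) x

/-- `E(x) = -(1 / 2π) log |x|`, so that `-ΔE = δ₀`. -/
noncomputable def laplaceE (x : ℝ × ℝ) : ℝ :=
  -(1 / (2 * Real.pi)) * Real.log (Real.sqrt (x.1 ^ 2 + x.2 ^ 2))

/-- The Green function `D(x, y) = E(x - y) - E(x - y*)` of the Dirichlet Laplacian. -/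
noncomputable def greenD (x y : ℝ × ℝ) : ℝ := laplaceE (x - y) - laplaceE (x - refl y)

/-- The heat kernel `Γ(x, t) = (4πt)⁻¹ exp(-|x|² / 4t)` of the plane. -/
noncomputable def heatKernel (x : ℝ × ℝ) (t : ℝ) : ℝ :=
  1 / (4 * Real.pi * t) * Real.exp (-(x.1 ^ 2 + x.2 ^ 2) / (4 * t))

/-- The integral `∫ f dμ` against a finite real measure, through its Jordan decomposition. -/
noncomputable def signedIntegral {X : Type*} [MeasurableSpace X] (μ : SignedMeasure X)
    (f : X → ℝ) : ℝ :=
  ∫ y, f y ∂μ.toJordanDecomposition.posPart - ∫ y, f y ∂μ.toJordanDecomposition.negPart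

/-- The Biot-Savart law `Kμ(x) = ∫ ∇^⊥_x D(x, y) μ(dy)`. -/
noncomputable def biotSavart (μ : SignedMeasure closedHalfPlane) (x : ℝ × ℝ) (i : Fin 2) : ℝ :=
  signedIntegral μ (fun y => gradPerp (fun x' => greenD x' y) x i)

/-- The Green matrix of the Stokes semigroup on the half plane with the no-slip condition,
`G_ij(x, z, t) = (Γ(x - z, t) - Γ(x - z*, t)) δ_ij
  - 4 (1 - δ_{j2}) ∂_{x_j} ∫_0^{x₂} ∫_ℝ (∂_i E)(x - w) Γ(w - z*, t) dw₁ dw₂`. -/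
noncomputable def stokesGreen (i j : Fin 2) (x z : ℝ × ℝ) (t : ℝ) : ℝ :=
  (heatKernel (x - z) t - heatKernel (x - refl z) t) * (if i = j then 1 else 0)
    - 4 * (1 - (if j = 1 then 1 else 0)) *
      pderiv j (fun x' => ∫ w₂ in (0 : ℝ)..x'.2, ∫ w₁ : ℝ,
        pderiv i laplaceE (x' - (w₁, w₂)) * heatKernel ((w₁, w₂) - refl z) t) x

/-- The Stokes semigroup `S(t) u(x) = ∫_{z₂ > 0} G(x, z, t) u(z) dz`. -/
noncomputable def stokes (t : ℝ) (u : ℝ × ℝ → Fin 2 → ℝ) (x : ℝ × ℝ) (i : Fin 2) : ℝ :=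
  ∫ z in halfPlane, ∑ j, stokesGreen i j x z t * u z j

/-- The vorticity of the Stokes flow with initial vorticity `μ`, `T(t) μ = -∇^⊥ · S(t) K μ`. -/
noncomputable def vorticity (t : ℝ) (μ : SignedMeasure closedHalfPlane) (x : ℝ × ℝ) : ℝ :=
  -divPerp (stokes t (biotSavart μ)) x

end HalfPlaneStokes

/-!
# Decay of the Stokes vorticity in a half plane

The proof computes the kernel of `T(t)`. Write `Γ₁` for the heat kernel of the line (`gauss`), `P_b`
and `Q_b` for the Poisson kernel and its conjugate, and
`F_n(ζ) = π⁻¹ ∫_0^∞ ξ^n exp(iζξ - tξ²) dξ` (`halfFourier`), so that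
`F_0(a + ib) = ((P_b + iQ_b) * Γ₁)(a)` for `b > 0`.

*The Green matrix.* Since `∂₂E` and `∂₁E` are `-P/2` and `-Q/2`, the strip integral in the Green
matrix is a one-dimensional integral of `F_0` against `Γ₁` (`strip_eq`), and `G` is an explicit
expression in `F_1` (`stokesGreen_zero`, `stokesGreen_one`). For `n ≥ 1` the function `F_n` decays
quadratically in the upper half plane, so `G` and its first derivatives are dominated by
`1 / ((1 + z₁²)(1 + z₂²))`, locally uniformly in `x` (`exists_green_le`). The Biot–Savart kernel is
integrable against this weight, uniformly in `y`, because it is bounded by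
`|z₁ - y₁|^{-1/2} |z₂ - y₂|^{-1/2}` (`integral_norm_weight_mul_velKernel_le`). This gives all the
convergence and differentiability, and permits Fubini.

*The kernel of the vorticity.* In `-∇^⊥ · S(t) u` the strip integrals cancel by the Cauchy–Riemann
equations for `F_n`, and what remains is a kernel `curlKernel` without them. Integrated against the
Biot–Savart kernel of a point mass at `y` it gives, after the integration in the tangential variable,
a derivative in the normal variable on each side of the height `y₂`, up to one term
(`integral_curlKernel_mul_velKernel`). The result is
`W(x, y, t) = Γ(x - y) - Γ(x - y*) + 2 ∫_0^{y₂} Γ₁'(x₂ + s) (P_{y₂ - s} * Γ₁)(x₁ - y₁) ds`.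

*Decay.* Both the `L¹` norm of `W(·, y, t)` and `t` times its supremum are at most a constant times
`min(1, y₂ / √t)` (`lintegral_vorticityKernel_le`, `abs_vorticityKernel_le`). For fixed `y` this
tends to `0` as `t → ∞`, so by dominated convergence in `y` the same holds for
`‖T(t)ω₀‖₁` and `t ‖T(t)ω₀‖_∞`, and the other exponents follow by interpolation
(`mul_eLpNorm_le_of_bounds`).
-/

namespace HalfPlaneStokes

/-! ### The one-dimensional heat kernel -/

/-- The heat kernel `(4πt)^{-1/2} exp(-s² / 4t)` of the line. -/
noncomputable def gauss (t s : ℝ) : ℝ := (√(4 * Real.pi * t))⁻¹ * Real.exp (-s ^ 2 / (4 * t))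

/-- The derivative of the heat kernel of the line in the space variable. -/
noncomputable def gaussDeriv (t s : ℝ) : ℝ := -(s / (2 * t)) * gauss t s

section
variable {t : ℝ}

lemma gauss_nonneg (t s : ℝ) : 0 ≤ gauss t s := by unfold gauss; positivity

lemma gauss_neg (t s : ℝ) : gauss t (-s) = gauss t s := by simp [gauss]

lemma continuous_gauss (t : ℝ) : Continuous (gauss t) := by unfold gauss; fun_prop

lemma continuous_gaussDeriv (t : ℝ) : Continuous (gaussDeriv t) := by
  have := continuous_gauss t
  unfold gaussDeriv; fun_prop

lemma heatKernel_eq (ht : 0 < t) (x : ℝ × ℝ) :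
    heatKernel x t = gauss t x.1 * gauss t x.2 := by
  have h : 0 < 4 * Real.pi * t := by positivity
  have e : -(x.1 ^ 2 + x.2 ^ 2) / (4 * t) = -x.1 ^ 2 / (4 * t) + -x.2 ^ 2 / (4 * t) := by ring
  rw [heatKernel, gauss, gauss, e, Real.exp_add]
  nth_rw 1 [← Real.sq_sqrt h.le]
  field_simp

lemma hasDerivAt_gauss (ht : 0 < t) (s : ℝ) : HasDerivAt (gauss t) (gaussDeriv t s) s := by
  have h : HasDerivAt (fun s : ℝ => -s ^ 2 / (4 * t)) (-(s / (2 * t))) s := by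
    have := ((hasDerivAt_pow 2 s).neg).div_const (4 * t)
    refine this.congr_deriv ?_
    simp; field_simp; ring
  refine (h.exp.const_mul (√(4 * Real.pi * t))⁻¹).congr_deriv ?_
  simp only [gaussDeriv, gauss]; ring

lemma gauss_le (ht : 0 < t) (s : ℝ) : gauss t s ≤ (√(4 * Real.pi * t))⁻¹ := by
  unfold gauss
  refine mul_le_of_le_one_right (by positivity) (Real.exp_le_one_iff.2 ?_)
  exact div_nonpos_of_nonpos_of_nonneg (by nlinarith [sq_nonneg s]) (by positivity)

lemma gauss_le_gauss (ht : 0 < t) {r s : ℝ} (h : |r| ≤ |s|) : gauss t s ≤ gauss t r := by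
  unfold gauss
  have := sq_le_sq.2 h
  gcongr

lemma integrable_gauss (ht : 0 < t) : Integrable (gauss t) := by
  have := (integrable_exp_neg_mul_sq (b := 1 / (4 * t)) (by positivity)).const_mul
    (√(4 * Real.pi * t))⁻¹
  refine this.congr (ae_of_all _ fun s => ?_)
  simp only [gauss]; congr 2; ring

lemma integral_gauss_eq_one (ht : 0 < t) : ∫ s, gauss t s = 1 := by
  have := integral_gaussian (1 / (4 * t))
  unfold gauss
  rw [integral_const_mul]
  have e : (fun s : ℝ => Real.exp (-s ^ 2 / (4 * t)))
    = fun s : ℝ => Real.exp (-(1 / (4 * t)) * s ^ 2) := by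
    ext s; congr 1; ring
  rw [e, this]
  have e2 : Real.pi / (1 / (4 * t)) = 4 * Real.pi * t := by field_simp
  rw [e2]
  have h : 0 < 4 * Real.pi * t := by positivity
  exact inv_mul_cancel₀ (Real.sqrt_pos.2 h).ne'

lemma exp_neg_sq_div_le {c : ℝ} (hc : 0 < c) (s : ℝ) :
    Real.exp (-s ^ 2 / c) ≤ (1 + c) / (1 + s ^ 2) := by
  have h1 : 1 + s ^ 2 / c ≤ Real.exp (s ^ 2 / c) := by
    linarith [Real.add_one_le_exp (s ^ 2 / c)]
  rw [neg_div, Real.exp_neg, inv_le_comm₀ (Real.exp_pos _) (by positivity), inv_div]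
  refine le_trans ?_ h1
  rw [div_le_iff₀ (by positivity)]
  have : (1 + s ^ 2 / c) * (1 + c) = 1 + s ^ 2 + s ^ 2 / c + c := by field_simp; ring
  rw [this]
  have : 0 ≤ s ^ 2 / c := by positivity
  linarith

lemma abs_mul_exp_neg_sq_div_le {c : ℝ} (hc : 0 < c) (s : ℝ) :
    |s| * Real.exp (-s ^ 2 / c) ≤ √c := by
  have h1 : 1 + s ^ 2 / c ≤ Real.exp (s ^ 2 / c) := by
    linarith [Real.add_one_le_exp (s ^ 2 / c)]
  rw [neg_div, Real.exp_neg, ← div_eq_mul_inv, div_le_iff₀ (Real.exp_pos _)]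
  refine le_trans ?_ (mul_le_mul_of_nonneg_left h1 (Real.sqrt_nonneg c))
  have hs : 0 < √c := Real.sqrt_pos.2 hc
  set r := |s| / √c with hr
  have e1 : |s| = r * √c := by rw [hr]; field_simp
  have e2 : s ^ 2 / c = r ^ 2 := by rw [hr, div_pow, sq_abs, Real.sq_sqrt hc.le]
  rw [e2, e1]
  nlinarith [sq_nonneg (r - 1 / 2)]

lemma abs_gaussDeriv_le (ht : 0 < t) (s : ℝ) : |gaussDeriv t s| ≤ 1 / t := by
  have h := abs_mul_exp_neg_sq_div_le (c := 4 * t) (by positivity) s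
  have e : √(4 * Real.pi * t) = √Real.pi * √(4 * t) := by
    rw [← Real.sqrt_mul Real.pi_pos.le]; congr 1; ring
  have hs : 0 < √(4 * t) := Real.sqrt_pos.2 (by positivity)
  have hp : 1 ≤ √Real.pi := Real.one_le_sqrt.2 (by linarith [Real.pi_gt_three])
  have : |gaussDeriv t s|
      = (1 / (2 * t)) * (√Real.pi)⁻¹ * ((√(4 * t))⁻¹ * (|s| * Real.exp (-s ^ 2 / (4 * t)))) := by
    rw [gaussDeriv, abs_mul, abs_of_nonneg (gauss_nonneg t s), gauss, e, abs_neg, abs_div,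
      abs_of_pos (show 0 < 2 * t by positivity), mul_inv]
    ring
  rw [this]
  have h2 : (√(4 * t))⁻¹ * (|s| * Real.exp (-s ^ 2 / (4 * t))) ≤ 1 := by
    rw [inv_mul_le_iff₀ hs]; simpa using h
  have h3 : (√Real.pi)⁻¹ ≤ 1 := inv_le_one_of_one_le₀ hp
  calc (1 / (2 * t)) * (√Real.pi)⁻¹ * ((√(4 * t))⁻¹ * (|s| * Real.exp (-s ^ 2 / (4 * t))))
      ≤ (1 / (2 * t)) * 1 * 1 := by gcongr
    _ ≤ 1 / t := by
      rw [mul_one, mul_one]; exact one_div_le_one_div_of_le ht (by linarith)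

lemma exists_gauss_le (ht : 0 < t) :
    ∃ K, 0 ≤ K ∧ ∀ s, |gauss t s| ≤ K / (1 + s ^ 2) ∧ |gaussDeriv t s| ≤ K / (1 + s ^ 2) := by
  set A := (√(4 * Real.pi * t))⁻¹
  have hA : 0 ≤ A := by positivity
  refine ⟨A * (1 + 4 * t) + (1 / (2 * t)) * A * (√(8 * t) * (1 + 8 * t)), by positivity,
    fun s => ⟨?_, ?_⟩⟩
  · rw [abs_of_nonneg (gauss_nonneg t s), add_div]
    refine le_add_of_le_of_nonneg ?_ (by positivity)
    rw [gauss, mul_div_assoc]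
    exact mul_le_mul_of_nonneg_left (exp_neg_sq_div_le (by positivity) s) hA
  · rw [add_div]
    refine le_add_of_nonneg_of_le (by positivity) ?_
    have e : Real.exp (-s ^ 2 / (4 * t)) =
        Real.exp (-s ^ 2 / (8 * t)) * Real.exp (-s ^ 2 / (8 * t)) := by
      rw [← Real.exp_add]; congr 1; field_simp; ring
    have : |gaussDeriv t s| = (1 / (2 * t)) * A *
        ((|s| * Real.exp (-s ^ 2 / (8 * t))) * Real.exp (-s ^ 2 / (8 * t))) := by
      rw [gaussDeriv, abs_mul, abs_of_nonneg (gauss_nonneg t s), gauss, abs_neg, abs_div,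
        abs_of_pos (show 0 < 2 * t by positivity), e]
      ring
    rw [this, mul_div_assoc, mul_div_assoc]
    gcongr
    · exact abs_mul_exp_neg_sq_div_le (by positivity) s
    · exact exp_neg_sq_div_le (by positivity) s

lemma integrable_gaussDeriv (ht : 0 < t) : Integrable (gaussDeriv t) := by
  obtain ⟨K, hK, h⟩ := exists_gauss_le ht
  refine (integrable_inv_one_add_sq.const_mul K).mono'
    (continuous_gaussDeriv t).aestronglyMeasurable (ae_of_all _ fun s => ?_)
  simpa [div_eq_mul_inv] using (h s).2

lemma tendsto_gauss_atTop (ht : 0 < t) : Tendsto (gauss t) atTop (𝓝 0) := by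
  obtain ⟨K, hK, h⟩ := exists_gauss_le ht
  refine squeeze_zero (fun s => gauss_nonneg t s) (fun s => (le_abs_self _).trans (h s).1) ?_
  refine Tendsto.div_atTop tendsto_const_nhds ?_
  exact tendsto_atTop_add_const_left _ _ (tendsto_pow_atTop two_ne_zero)

/-- The Fourier transform of the heat kernel. -/
lemma integral_gauss_mul_cexp (ht : 0 < t) (x ξ : ℝ) :
    ∫ s, (gauss t (x - s) : ℂ) * Complex.exp (Complex.I * s * ξ)
      = Complex.exp (Complex.I * x * ξ - t * ξ ^ 2) := by
  have h1 : ∫ s, (gauss t (x - s) : ℂ) * Complex.exp (Complex.I * s * ξ)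
      = ∫ s, (gauss t s : ℂ) * Complex.exp (Complex.I * ((x - s : ℝ) : ℂ) * ξ) := by
    rw [← integral_sub_left_eq_self _ _ x]
    simp
  have h2 : ∀ s : ℝ, (gauss t s : ℂ) * Complex.exp (Complex.I * ((x - s : ℝ) : ℂ) * ξ)
      = Complex.exp (Complex.I * x * ξ) * ((√(4 * Real.pi * t))⁻¹ : ℝ) *
        (Complex.exp (Complex.I * ((-ξ : ℝ) : ℂ) * s)
          * Complex.exp (-(1 / (4 * t) : ℝ) * s ^ 2)) := by
    intro s
    rw [gauss]
    push_cast
    rw [show Complex.I * ((x : ℂ) - s) * ξ = Complex.I * x * ξ + Complex.I * (-ξ) * s by ring,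
      Complex.exp_add, show -(s : ℂ) ^ 2 / (4 * t) = -(1 / (4 * t)) * s ^ 2 by ring]
    ring
  simp_rw [h1, h2]
  rw [integral_const_mul, fourierIntegral_gaussian (by simpa using ht)]
  have hπ : 0 < 4 * Real.pi * t := by positivity
  have h3 : ((Real.pi : ℂ) / ((1 / (4 * t) : ℝ) : ℂ)) ^ (1 / 2 : ℂ) = (√(4 * Real.pi * t) : ℝ) := by
    rw [Real.sqrt_eq_rpow, Complex.ofReal_cpow hπ.le]
    congr 1
    · push_cast
      have : (t : ℂ) ≠ 0 := by exact_mod_cast ht.ne'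
      field_simp
    · push_cast; rfl
  rw [h3, Complex.exp_sub]
  have h4 : ((√(4 * Real.pi * t) : ℝ) : ℂ) ≠ 0 := by
    exact_mod_cast (Real.sqrt_pos.2 hπ).ne'
  have h5 : -((-ξ : ℝ) : ℂ) ^ 2 / (4 * ((1 / (4 * t) : ℝ) : ℂ)) = -((t : ℂ) * ξ ^ 2) := by
    have : (t : ℂ) ≠ 0 := by exact_mod_cast ht.ne'
    push_cast
    field_simp
  rw [h5, Complex.exp_neg, Complex.ofReal_inv]
  field_simp

lemma integrable_gauss_mul_cexp (ht : 0 < t) (x ξ : ℝ) :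
    Integrable fun s : ℝ => (gauss t (x - s) : ℂ) * Complex.exp (Complex.I * s * ξ) := by
  refine ((integrable_gauss ht).comp_sub_left x).ofReal.mul_bdd (c := 1)
    (by fun_prop) (ae_of_all _ fun s => ?_)
  rw [Complex.norm_exp]; simp

lemma integrable_gaussDeriv_mul_cexp (ht : 0 < t) (x ξ : ℝ) :
    Integrable fun s : ℝ => (gaussDeriv t (x - s) : ℂ) * Complex.exp (Complex.I * s * ξ) := by
  refine ((integrable_gaussDeriv ht).comp_sub_left x).ofReal.mul_bdd (c := 1)
    (by fun_prop) (ae_of_all _ fun s => ?_)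
  rw [Complex.norm_exp]; simp

lemma integral_gaussDeriv_mul_cexp (ht : 0 < t) (x ξ : ℝ) :
    ∫ s, (gaussDeriv t (x - s) : ℂ) * Complex.exp (Complex.I * s * ξ)
      = Complex.I * ξ * Complex.exp (Complex.I * x * ξ - t * ξ ^ 2) := by
  have hd : ∀ s : ℝ, HasDerivAt
      (fun s : ℝ => (gauss t (x - s) : ℂ) * Complex.exp (Complex.I * s * ξ))
      (Complex.I * ξ * ((gauss t (x - s) : ℂ) * Complex.exp (Complex.I * s * ξ))
        - (gaussDeriv t (x - s) : ℂ) * Complex.exp (Complex.I * s * ξ)) s := by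
    intro s
    have h1 : HasDerivAt (fun s : ℝ => (gauss t (x - s) : ℂ)) ((-gaussDeriv t (x - s) : ℝ) : ℂ) s := by
      have := (hasDerivAt_gauss ht (x - s)).comp s ((hasDerivAt_id s).const_sub x)
      simpa using this.ofReal_comp
    have h2 : HasDerivAt (fun s : ℝ => Complex.exp (Complex.I * s * ξ))
        (Complex.exp (Complex.I * s * ξ) * (Complex.I * ξ)) s := by
      have h : HasDerivAt (fun s : ℝ => Complex.I * (s : ℂ) * ξ) (Complex.I * ξ) s := by
        simpa using ((Complex.ofRealCLM.hasDerivAt (x := s)).const_mul Complex.I).mul_const (ξ : ℂ)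
      exact h.cexp
    refine (h1.mul h2).congr_deriv ?_
    push_cast; ring
  have h0 := integral_eq_zero_of_hasDerivAt_of_integrable hd
    (((integrable_gauss_mul_cexp ht x ξ).const_mul _).sub (integrable_gaussDeriv_mul_cexp ht x ξ))
    (integrable_gauss_mul_cexp ht x ξ)
  rw [integral_sub ((integrable_gauss_mul_cexp ht x ξ).const_mul _)
    (integrable_gaussDeriv_mul_cexp ht x ξ), integral_const_mul, integral_gauss_mul_cexp ht] at h0
  exact (sub_eq_zero.1 h0).symm

end

/-! ### The half-line Fourier integrals -/

/-- The entire function `F_n(ζ) = π⁻¹ ∫_0^∞ ξ^n exp(iζξ - tξ²) dξ`. In the upper half plane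
`F_0(a + ib)` is the convolution of the heat kernel of the line with `P_b + i Q_b`, the Poisson
kernel and its conjugate, and `F_n` is up to a power of `i` the `n`-th derivative of `F_0`. -/
noncomputable def halfFourier (t : ℝ) (n : ℕ) (ζ : ℂ) : ℂ :=
  (1 / Real.pi) * ∫ ξ in Set.Ioi (0 : ℝ), (ξ : ℂ) ^ n * Complex.exp (Complex.I * ζ * ξ - t * ξ ^ 2)

/-- The bound `π⁻¹ ∫_0^∞ ξ^n exp(-tξ²) dξ` of `F_n` in the upper half plane. -/
noncomputable def halfMoment (t : ℝ) (n : ℕ) : ℝ :=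
  (1 / Real.pi) * ∫ ξ in Set.Ioi (0 : ℝ), ξ ^ n * Real.exp (-t * ξ ^ 2)

section
variable {t : ℝ}

lemma norm_halfFourier_integrand (n : ℕ) (ζ : ℂ) {ξ : ℝ} (hξ : 0 ≤ ξ) :
    ‖(ξ : ℂ) ^ n * Complex.exp (Complex.I * ζ * ξ - t * ξ ^ 2)‖
      = ξ ^ n * Real.exp (-ζ.im * ξ - t * ξ ^ 2) := by
  rw [norm_mul, norm_pow, Complex.norm_real, Real.norm_of_nonneg hξ, Complex.norm_exp]
  congr 2
  simp [← Complex.ofReal_pow]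

lemma integrableOn_pow_mul_exp (ht : 0 < t) (n : ℕ) (R : ℝ) :
    IntegrableOn (fun ξ : ℝ => ξ ^ n * Real.exp (R * ξ - t * ξ ^ 2)) (Set.Ioi 0) := by
  have h := (integrableOn_rpow_mul_exp_neg_mul_sq (b := t / 2) (by positivity)
    (s := n) (by have := n.cast_nonneg (α := ℝ); linarith)).const_mul (Real.exp (R ^ 2 / (2 * t)))
  refine h.mono' (by fun_prop) ?_
  filter_upwards [ae_restrict_mem measurableSet_Ioi] with ξ hξ
  have hξ : 0 < ξ := hξ
  rw [Real.norm_of_nonneg (by positivity), Real.rpow_natCast, mul_left_comm, ← Real.exp_add]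
  gcongr
  have : 0 ≤ (t * ξ - R) ^ 2 / (2 * t) := by positivity
  have e : (t * ξ - R) ^ 2 / (2 * t) = t / 2 * ξ ^ 2 - R * ξ + R ^ 2 / (2 * t) := by
    field_simp; ring
  linarith

lemma integrableOn_halfFourier (ht : 0 < t) (n : ℕ) (ζ : ℂ) :
    IntegrableOn (fun ξ : ℝ => (ξ : ℂ) ^ n * Complex.exp (Complex.I * ζ * ξ - t * ξ ^ 2))
      (Set.Ioi 0) := by
  refine (integrableOn_pow_mul_exp ht n (-ζ.im)).mono' (by fun_prop) ?_
  filter_upwards [ae_restrict_mem measurableSet_Ioi] with ξ hξ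
  rw [norm_halfFourier_integrand n ζ (le_of_lt hξ)]

lemma hasDerivAt_halfFourier (ht : 0 < t) (n : ℕ) (ζ : ℂ) :
    HasDerivAt (halfFourier t n) (Complex.I * halfFourier t (n + 1) ζ) ζ := by
  have h := (hasDerivAt_integral_of_dominated_loc_of_deriv_le
    (μ := volume.restrict (Set.Ioi (0 : ℝ))) (x₀ := ζ) (s := Metric.ball ζ 1)
    (F := fun (ζ : ℂ) (ξ : ℝ) => (ξ : ℂ) ^ n * Complex.exp (Complex.I * ζ * ξ - t * ξ ^ 2))
    (F' := fun (ζ : ℂ) (ξ : ℝ) =>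
      Complex.I * ((ξ : ℂ) ^ (n + 1) * Complex.exp (Complex.I * ζ * ξ - t * ξ ^ 2)))
    (bound := fun ξ => ξ ^ (n + 1) * Real.exp ((|ζ.im| + 1) * ξ - t * ξ ^ 2))
    (Metric.ball_mem_nhds ζ one_pos)
    (Eventually.of_forall fun ζ => by fun_prop) (integrableOn_halfFourier ht n ζ) (by fun_prop)
    ?_ (integrableOn_pow_mul_exp ht _ _) ?_).2
  · refine (h.const_mul (1 / Real.pi : ℂ)).congr_deriv ?_
    rw [integral_const_mul, halfFourier]
    ring
  · filter_upwards [ae_restrict_mem measurableSet_Ioi] with ξ hξ z hz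
    have hξ : 0 < ξ := hξ
    rw [norm_mul, Complex.norm_I, one_mul, norm_halfFourier_integrand _ _ hξ.le]
    gcongr
    have h1 : |(z - ζ).im| < 1 := (Complex.abs_im_le_norm _).trans_lt (by simpa [dist_eq_norm] using hz)
    rw [Complex.sub_im, abs_lt] at h1
    have := neg_abs_le ζ.im
    linarith [h1.1, h1.2]
  · refine ae_of_all _ fun ξ z _ => ?_
    have h1 : HasDerivAt (fun z : ℂ => Complex.I * z * ξ - t * ξ ^ 2) (Complex.I * ξ) z := by
      simpa using (((hasDerivAt_id z).const_mul Complex.I).mul_const (ξ : ℂ)).sub_const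
        ((t : ℂ) * ξ ^ 2)
    refine (h1.cexp.const_mul ((ξ : ℂ) ^ n)).congr_deriv ?_
    ring

lemma continuous_halfFourier (ht : 0 < t) (n : ℕ) : Continuous (halfFourier t n) :=
  continuous_iff_continuousAt.2 fun ζ => (hasDerivAt_halfFourier ht n ζ).continuousAt

lemma halfMoment_nonneg (t : ℝ) (n : ℕ) : 0 ≤ halfMoment t n := by
  refine mul_nonneg (by positivity) (setIntegral_nonneg measurableSet_Ioi fun ξ hξ => ?_)
  have : (0 : ℝ) < ξ := hξ
  positivity

lemma norm_halfFourier_le (ht : 0 < t) (n : ℕ) {ζ : ℂ} (hζ : 0 ≤ ζ.im) :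
    ‖halfFourier t n ζ‖ ≤ halfMoment t n := by
  rw [halfFourier, halfMoment, norm_mul]
  have : ‖(1 / Real.pi : ℂ)‖ = 1 / Real.pi := by
    rw [norm_div, norm_one, Complex.norm_real, Real.norm_of_nonneg Real.pi_pos.le]
  rw [this]
  refine mul_le_mul_of_nonneg_left ?_ (by positivity)
  refine norm_integral_le_of_norm_le ?_ ?_
  · simpa [IntegrableOn] using integrableOn_pow_mul_exp ht n 0
  · filter_upwards [ae_restrict_mem measurableSet_Ioi] with ξ hξ
    have hξ : 0 < ξ := hξ
    rw [norm_halfFourier_integrand _ _ hξ.le]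
    gcongr
    have := mul_nonneg hζ hξ.le
    linarith

/-- Integration by parts in `ξ`. -/
lemma halfFourier_recursion (ht : 0 < t) (n : ℕ) (ζ : ℂ) :
    Complex.I * ζ * halfFourier t n ζ = 2 * t * halfFourier t (n + 1) ζ
      - n * halfFourier t (n - 1) ζ - if n = 0 then 1 / (Real.pi : ℂ) else 0 := by
  set e : ℝ → ℂ := fun ξ => Complex.exp (Complex.I * ζ * ξ - t * ξ ^ 2) with he
  have hd : ∀ ξ ∈ Set.Ici (0 : ℝ), HasDerivAt (fun ξ : ℝ => (ξ : ℂ) ^ n * e ξ)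
      (n * ((ξ : ℂ) ^ (n - 1) * e ξ) + Complex.I * ζ * ((ξ : ℂ) ^ n * e ξ)
        - 2 * t * ((ξ : ℂ) ^ (n + 1) * e ξ)) ξ := by
    intro ξ _
    have h1 : HasDerivAt (fun z : ℂ => Complex.I * ζ * z - t * z ^ 2)
        (Complex.I * ζ - t * (2 * ξ)) (ξ : ℂ) := by
      have h := ((hasDerivAt_id (ξ : ℂ)).const_mul (Complex.I * ζ)).sub
        ((hasDerivAt_pow 2 (ξ : ℂ)).const_mul (t : ℂ))
      exact h.congr_deriv (by simp)
    have h2 := ((hasDerivAt_pow n (ξ : ℂ)).mul h1.cexp).comp_ofReal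
    refine h2.congr_deriv ?_
    simp only [he]; ring
  have i1 : IntegrableOn (fun ξ : ℝ => n * ((ξ : ℂ) ^ (n - 1) * e ξ)) (Set.Ioi 0) :=
    (integrableOn_halfFourier ht (n - 1) ζ).const_mul (n : ℂ)
  have i2 : IntegrableOn (fun ξ : ℝ => Complex.I * ζ * ((ξ : ℂ) ^ n * e ξ)) (Set.Ioi 0) :=
    (integrableOn_halfFourier ht n ζ).const_mul (Complex.I * ζ)
  have i3 : IntegrableOn (fun ξ : ℝ => 2 * t * ((ξ : ℂ) ^ (n + 1) * e ξ)) (Set.Ioi 0) :=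
    (integrableOn_halfFourier ht (n + 1) ζ).const_mul (2 * t : ℂ)
  have i12 : IntegrableOn (fun ξ : ℝ => n * ((ξ : ℂ) ^ (n - 1) * e ξ)
      + Complex.I * ζ * ((ξ : ℂ) ^ n * e ξ)) (Set.Ioi 0) := i1.add i2
  have h := integral_Ioi_of_hasDerivAt_of_tendsto' hd (i12.sub i3)
    (tendsto_zero_of_hasDerivAt_of_integrableOn_Ioi (fun x hx => hd x (Set.Ioi_subset_Ici_self hx))
      (i12.sub i3) (integrableOn_halfFourier ht n ζ))
  rw [integral_sub i12 i3, integral_add i1 i2, integral_const_mul, integral_const_mul,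
    integral_const_mul] at h
  have hb : ((0 : ℝ) : ℂ) ^ n * e 0 = if n = 0 then 1 else 0 := by
    rcases eq_or_ne n 0 with rfl | hn
    · simp [he]
    · simp [hn]
  rw [hb] at h
  simp only [halfFourier]
  have h' := congrArg (fun z : ℂ => (1 / Real.pi : ℂ) * z) h
  split_ifs with hn <;> simp only [hn, if_true, if_false] at h' ⊢ <;> linear_combination h'

/-- `F_n` decays like `|ζ|⁻²` in the upper half plane when `n ≥ 1`. -/
lemma exists_norm_halfFourier_le (ht : 0 < t) {n : ℕ} (hn : n ≠ 0) :
    ∃ K, 0 ≤ K ∧ ∀ a b : ℝ, 0 ≤ b →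
      ‖halfFourier t n (a + b * Complex.I)‖ ≤ K / (1 + a ^ 2) := by
  have hone : ∀ (m : ℕ) (ζ : ℂ), 0 ≤ ζ.im → ‖ζ * halfFourier t m ζ‖
      ≤ 2 * t * halfMoment t (m + 1) + m * halfMoment t (m - 1) + 1 / Real.pi := by
    intro m ζ hζ
    have h := halfFourier_recursion ht m ζ
    have e : ‖ζ * halfFourier t m ζ‖ = ‖Complex.I * ζ * halfFourier t m ζ‖ := by
      simp
    rw [e, h]
    refine (norm_sub_le _ _).trans (add_le_add ((norm_sub_le _ _).trans (add_le_add ?_ ?_)) ?_)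
    · rw [norm_mul, norm_mul, Complex.norm_real, Real.norm_of_nonneg ht.le, Complex.norm_two]
      gcongr
      exact norm_halfFourier_le ht _ hζ
    · rw [norm_mul, Complex.norm_natCast]
      gcongr
      exact norm_halfFourier_le ht _ hζ
    · split_ifs
      · rw [norm_div, norm_one, Complex.norm_real, Real.norm_of_nonneg Real.pi_pos.le]
      · rw [norm_zero]; positivity
  set B : ℕ → ℝ := fun m => 2 * t * halfMoment t (m + 1) + m * halfMoment t (m - 1) + 1 / Real.pi
  have hB : ∀ m, 0 ≤ B m := fun m => by
    have := halfMoment_nonneg t (m + 1)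
    have := halfMoment_nonneg t (m - 1)
    positivity
  refine ⟨halfMoment t n + (2 * t * B (n + 1) + n * B (n - 1)), ?_, fun a b hb => ?_⟩
  · have := halfMoment_nonneg t n
    have := hB (n + 1)
    have := hB (n - 1)
    positivity
  set ζ : ℂ := a + b * Complex.I with hζdef
  have hζ : 0 ≤ ζ.im := by simpa [hζdef] using hb
  have ha : a ^ 2 ≤ ‖ζ‖ ^ 2 := by
    rw [Complex.sq_norm, Complex.normSq_apply]
    simp [hζdef]; nlinarith
  rw [le_div_iff₀ (by positivity)]
  have h2 : ‖ζ * (ζ * halfFourier t n ζ)‖ ≤ 2 * t * B (n + 1) + n * B (n - 1) := by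
    have h := halfFourier_recursion ht n ζ
    rw [if_neg hn, sub_zero] at h
    have e : ‖ζ * (ζ * halfFourier t n ζ)‖ = ‖ζ * (Complex.I * ζ * halfFourier t n ζ)‖ := by
      simp
    have e2 : ζ * (2 * t * halfFourier t (n + 1) ζ - n * halfFourier t (n - 1) ζ)
        = 2 * t * (ζ * halfFourier t (n + 1) ζ) - n * (ζ * halfFourier t (n - 1) ζ) := by ring
    rw [e, h, e2]
    refine (norm_sub_le _ _).trans (add_le_add ?_ ?_)
    · rw [norm_mul, norm_mul, Complex.norm_real, Real.norm_of_nonneg ht.le, Complex.norm_two]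
      gcongr
      exact hone _ _ hζ
    · rw [norm_mul, Complex.norm_natCast]
      gcongr
      exact hone _ _ hζ
  rw [← mul_assoc, norm_mul, norm_mul] at h2
  have h1 := norm_halfFourier_le ht n hζ
  nlinarith [norm_nonneg (halfFourier t n ζ)]

/-- On the real axis the real part of `F_0` is the heat kernel of the line. -/
lemma re_halfFourier_zero (ht : 0 < t) (a : ℝ) : (halfFourier t 0 a).re = gauss t a := by
  set f : ℝ → ℂ := fun ξ => Complex.exp (Complex.I * a * ξ - t * ξ ^ 2) with hf
  have hfi : Integrable f := by
    have := integrable_cexp_quadratic (b := t) (by simpa using ht) (Complex.I * a) 0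
    refine this.congr (ae_of_all _ fun ξ => ?_)
    simp only [hf]; congr 1; ring
  have hfull : ∫ ξ, f ξ = (2 * Real.pi * gauss t a : ℝ) := by
    have h := fourierIntegral_gaussian (b := t) (by simpa using ht) a
    have e : ∀ ξ : ℝ, f ξ = Complex.exp (Complex.I * a * ξ) * Complex.exp (-t * ξ ^ 2) := by
      intro ξ; rw [← Complex.exp_add]; simp only [hf]; congr 1; ring
    simp_rw [e]
    rw [h]
    have h1 : ((Real.pi : ℂ) / t) ^ (1 / 2 : ℂ) = (√(Real.pi / t) : ℝ) := by
      rw [Real.sqrt_eq_rpow, Complex.ofReal_cpow (by positivity)]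
      push_cast; rfl
    have h2 : √(Real.pi / t) = 2 * Real.pi * (√(4 * Real.pi * t))⁻¹ := by
      have hp : 0 < 4 * Real.pi * t := by positivity
      have hs := Real.sqrt_pos.2 hp
      rw [← div_eq_mul_inv, eq_div_iff hs.ne', ← Real.sqrt_mul (by positivity)]
      rw [show Real.pi / t * (4 * Real.pi * t) = (2 * Real.pi) ^ 2 by field_simp; ring]
      exact Real.sqrt_sq (by positivity)
    rw [h1, h2, gauss]
    push_cast
    ring
  have hconj : ∀ ξ : ℝ, f (-ξ) = (starRingEnd ℂ) (f ξ) := by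
    intro ξ
    simp only [hf, ← Complex.exp_conj]
    congr 1
    simp
  have hneg : ∫ ξ in Set.Iic (0 : ℝ), f ξ = (starRingEnd ℂ) (∫ ξ in Set.Ioi (0 : ℝ), f ξ) := by
    rw [← integral_conj, ← neg_zero, ← integral_comp_neg_Iic, neg_zero]
    refine setIntegral_congr_fun measurableSet_Iic fun ξ _ => ?_
    simp only [← hconj, neg_neg]
  have hsplit : ∫ ξ, f ξ = (∫ ξ in Set.Iic (0 : ℝ), f ξ) + ∫ ξ in Set.Ioi (0 : ℝ), f ξ := by
    rw [← setIntegral_union (Set.Iic_disjoint_Ioi le_rfl) measurableSet_Ioi hfi.integrableOn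
      hfi.integrableOn, Set.Iic_union_Ioi, setIntegral_univ]
  rw [hneg, hfull] at hsplit
  have hre := congrArg Complex.re hsplit
  simp only [Complex.ofReal_re, Complex.add_re, Complex.conj_re] at hre
  rw [halfFourier]
  simp only [pow_zero, one_mul]
  change ((1 / (Real.pi : ℂ)) * ∫ ξ in Set.Ioi (0 : ℝ), f ξ).re = _
  rw [show (1 / (Real.pi : ℂ)) = ((1 / Real.pi : ℝ) : ℂ) by push_cast; rfl, Complex.re_ofReal_mul]
  field_simp
  linarith

lemma hasDerivAt_halfFourier_re (ht : 0 < t) (n : ℕ) (a b : ℝ) :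
    HasDerivAt (fun s : ℝ => halfFourier t n (s + b * Complex.I))
      (Complex.I * halfFourier t (n + 1) (a + b * Complex.I)) a := by
  have h := (hasDerivAt_halfFourier ht n (a + b * Complex.I)).comp_add_const (a : ℂ) (b * Complex.I)
  exact h.comp_ofReal

lemma hasDerivAt_halfFourier_im (ht : 0 < t) (n : ℕ) (a b : ℝ) :
    HasDerivAt (fun s : ℝ => halfFourier t n (a + s * Complex.I))
      (-halfFourier t (n + 1) (a + b * Complex.I)) b := by
  have h1 : HasDerivAt (fun z : ℂ => (a : ℂ) + z * Complex.I) Complex.I (b : ℂ) := by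
    simpa using ((hasDerivAt_id (b : ℂ)).mul_const Complex.I).const_add (a : ℂ)
  have h := ((hasDerivAt_halfFourier ht n (a + b * Complex.I)).comp (b : ℂ) h1).comp_ofReal
  refine h.congr_deriv ?_
  rw [mul_right_comm, Complex.I_mul_I, neg_one_mul]

end

/-! ### Convolutions with the Poisson kernel and its conjugate -/

/-- The Cauchy kernel `i / (πζ)`. At `ζ = a + ib` its real part is the Poisson kernel `P_b(a)` and
its imaginary part is the conjugate Poisson kernel `Q_b(a)`. -/
noncomputable def cauchyKernel (ζ : ℂ) : ℂ := Complex.I / (Real.pi * ζ)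

/-- The Poisson kernel `P_b(a) = b / (π (a² + b²))`. -/
noncomputable def poisson (b a : ℝ) : ℝ := b / (Real.pi * (a ^ 2 + b ^ 2))

/-- The conjugate Poisson kernel `Q_b(a) = a / (π (a² + b²))`. -/
noncomputable def conjPoisson (b a : ℝ) : ℝ := a / (Real.pi * (a ^ 2 + b ^ 2))

lemma cauchyKernel_eq (a b : ℝ) : cauchyKernel (a + b * Complex.I)
    = poisson b a + conjPoisson b a * Complex.I := by
  unfold cauchyKernel poisson conjPoisson
  by_cases h : a ^ 2 + b ^ 2 = 0
  · have ha : a = 0 := by nlinarith [sq_nonneg a, sq_nonneg b]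
    have hb : b = 0 := by nlinarith [sq_nonneg a, sq_nonneg b]
    simp [ha, hb]
  · have h' : (a : ℂ) ^ 2 + (b : ℂ) ^ 2 ≠ 0 := by exact_mod_cast h
    have key : ((a : ℂ) + b * Complex.I) * (b + a * Complex.I) = Complex.I * (a ^ 2 + b ^ 2) := by
      linear_combination a * b * Complex.I_sq
    have hζ : (a : ℂ) + b * Complex.I ≠ 0 := by
      intro h0
      rw [h0, zero_mul] at key
      exact mul_ne_zero Complex.I_ne_zero h' key.symm
    have hπ : (Real.pi : ℂ) ≠ 0 := by exact_mod_cast Real.pi_ne_zero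
    push_cast
    rw [div_mul_eq_mul_div, ← add_div, div_eq_div_iff (mul_ne_zero hπ hζ) (mul_ne_zero hπ h')]
    linear_combination -(Real.pi : ℂ) * key

lemma cauchyKernel_re (a b : ℝ) : (cauchyKernel (a + b * Complex.I)).re = poisson b a := by
  simp [cauchyKernel_eq]

lemma cauchyKernel_im (a b : ℝ) : (cauchyKernel (a + b * Complex.I)).im = conjPoisson b a := by
  simp [cauchyKernel_eq]

lemma poisson_nonneg {b : ℝ} (hb : 0 ≤ b) (a : ℝ) : 0 ≤ poisson b a := by
  have := Real.pi_pos
  unfold poisson; positivity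

lemma norm_cauchyKernel_le {b : ℝ} (hb : 0 < b) (a : ℝ) :
    ‖cauchyKernel (a + b * Complex.I)‖ ≤ 1 / (Real.pi * b) := by
  rw [cauchyKernel, norm_div, Complex.norm_I, norm_mul, Complex.norm_real,
    Real.norm_of_nonneg Real.pi_pos.le]
  have hπ := Real.pi_pos
  gcongr
  have := Complex.abs_im_le_norm (a + b * Complex.I)
  simp only [Complex.add_im, Complex.ofReal_im, Complex.mul_im, Complex.ofReal_re, Complex.I_im,
    mul_one, Complex.I_re, mul_zero, add_zero, zero_add] at this
  rwa [abs_of_pos hb] at this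

lemma continuous_cauchyKernel {b : ℝ} (hb : 0 < b) :
    Continuous fun a : ℝ => cauchyKernel (a + b * Complex.I) := by
  unfold cauchyKernel
  refine continuous_const.div (by fun_prop) fun a => mul_ne_zero ?_ ?_
  · exact_mod_cast Real.pi_ne_zero
  · intro h
    have := congrArg Complex.im h
    simp at this
    exact hb.ne' this

lemma cauchyKernel_eq_integral {ζ : ℂ} (hζ : 0 < ζ.im) :
    cauchyKernel ζ = (1 / Real.pi) * ∫ ξ in Set.Ioi (0 : ℝ), Complex.exp (Complex.I * ζ * ξ) := by
  rw [integral_exp_mul_complex_Ioi (by simpa using hζ), cauchyKernel]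
  have hζ0 : ζ ≠ 0 := by rintro rfl; simp at hζ
  simp
  field_simp
  rw [Complex.I_sq]

/-- A convolution with the Cauchy kernel is a half-line Fourier integral. -/
lemma integral_mul_cauchyKernel {φ : ℝ → ℝ} (hφ : Integrable φ) {h : ℝ → ℂ} (x : ℝ)
    (hh : ∀ ξ : ℝ, ∫ s, (φ (x - s) : ℂ) * Complex.exp (Complex.I * s * ξ) = h ξ)
    {b : ℝ} (hb : 0 < b) :
    ∫ s, (φ (x - s) : ℂ) * cauchyKernel (s + b * Complex.I)
      = (1 / Real.pi) * ∫ ξ in Set.Ioi (0 : ℝ), h ξ * Complex.exp (-b * ξ) := by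
  have e1 : ∀ s : ℝ, (φ (x - s) : ℂ) * cauchyKernel (s + b * Complex.I)
      = (1 / Real.pi) * ∫ ξ in Set.Ioi (0 : ℝ), (φ (x - s) : ℂ)
        * Complex.exp (Complex.I * s * ξ) * Complex.exp (-b * ξ) := by
    intro s
    rw [cauchyKernel_eq_integral (by simpa using hb), mul_left_comm, ← integral_const_mul]
    congr 2; ext ξ
    rw [mul_assoc _ (Complex.exp _), ← Complex.exp_add]
    congr 2
    linear_combination b * ξ * Complex.I_sq
  simp_rw [e1]
  rw [integral_const_mul, integral_integral_swap]
  · congr 2; ext ξ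
    rw [integral_mul_const, hh]
  · have i1 : Integrable (fun ξ : ℝ => Complex.exp (-b * ξ)) (volume.restrict (Set.Ioi 0)) :=
      integrableOn_exp_mul_complex_Ioi (by simpa using hb) 0
    have i2 := ((hφ.comp_sub_left x).ofReal (𝕜 := ℂ)).mul_prod i1
    refine (i2.bdd_mul (c := 1) (f := fun p : ℝ × ℝ => Complex.exp (Complex.I * p.1 * p.2))
      (by fun_prop) (ae_of_all _ fun p => ?_)).congr (ae_of_all _ fun p => ?_)
    · rw [Complex.norm_exp]; simp
    · simp only [Function.uncurry]
      change _ * ((φ (x - p.1) : ℂ) * _) = _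
      ring

section
variable {t : ℝ}

lemma integral_gauss_mul_cauchyKernel (ht : 0 < t) (x : ℝ) {b : ℝ} (hb : 0 < b) :
    ∫ s, (gauss t (x - s) : ℂ) * cauchyKernel (s + b * Complex.I)
      = halfFourier t 0 (x + b * Complex.I) := by
  rw [integral_mul_cauchyKernel (integrable_gauss ht) x
    (fun ξ => integral_gauss_mul_cexp ht x ξ) hb, halfFourier]
  congr 2; ext ξ
  rw [← Complex.exp_add, pow_zero, one_mul]
  congr 1
  linear_combination -b * ξ * Complex.I_sq

lemma integral_gaussDeriv_mul_cauchyKernel (ht : 0 < t) (x : ℝ) {b : ℝ} (hb : 0 < b) :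
    ∫ s, (gaussDeriv t (x - s) : ℂ) * cauchyKernel (s + b * Complex.I)
      = Complex.I * halfFourier t 1 (x + b * Complex.I) := by
  rw [integral_mul_cauchyKernel (integrable_gaussDeriv ht) x
    (fun ξ => integral_gaussDeriv_mul_cexp ht x ξ) hb, halfFourier, mul_left_comm,
    ← integral_const_mul Complex.I]
  congr 2; ext ξ
  rw [mul_assoc _ (Complex.exp _), ← Complex.exp_add, pow_one, mul_assoc]
  congr 3
  linear_combination -b * ξ * Complex.I_sq

lemma integrable_mul_cauchyKernel {φ : ℝ → ℝ} (hφ : Integrable φ) (x : ℝ) {b : ℝ} (hb : 0 < b) :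
    Integrable fun s : ℝ => (φ (x - s) : ℂ) * cauchyKernel (s + b * Complex.I) :=
  ((hφ.comp_sub_left x).ofReal (𝕜 := ℂ)).mul_bdd (c := 1 / (Real.pi * b))
    (continuous_cauchyKernel hb).aestronglyMeasurable (ae_of_all _ fun s => norm_cauchyKernel_le hb s)

lemma integrable_poisson {b : ℝ} (hb : 0 < b) : Integrable (poisson b) := by
  have h := (integrable_inv_one_add_sq.comp_div hb.ne').const_mul (1 / (Real.pi * b))
  refine h.congr (ae_of_all _ fun a => ?_)
  simp only [poisson]
  have := Real.pi_pos
  have : a ^ 2 + b ^ 2 ≠ 0 := by positivity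
  have : b ^ 2 + a ^ 2 ≠ 0 := by positivity
  field_simp
  ring

lemma continuous_poisson {b : ℝ} (hb : 0 < b) : Continuous (poisson b) := by
  unfold poisson
  refine continuous_const.div (by fun_prop) fun a => ?_
  have := Real.pi_pos
  positivity

/-- The Fourier transform of the Poisson kernel, by Fourier inversion. -/
lemma integral_poisson_mul_cexp {b : ℝ} (hb : 0 < b) (ξ : ℝ) :
    ∫ s, (poisson b s : ℂ) * Complex.exp (-(Complex.I * s * ξ)) = Real.exp (-b * |ξ|) := by
  set f : ℝ → ℂ := fun v => (Real.exp (-(2 * Real.pi * b) * |v|) : ℝ) with hf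
  have hπ := Real.pi_pos
  have hc : 0 < 2 * Real.pi * b := by positivity
  have hfc : Continuous f := by fun_prop
  have hfi : Integrable f := by
    refine Integrable.ofReal (f := fun v => Real.exp (-(2 * Real.pi * b) * |v|)) ?_
    rw [← integrableOn_univ, ← Set.Iic_union_Ioi (a := (0 : ℝ)), integrableOn_union]
    have h0 : ∀ v ∈ Set.Ioi (0 : ℝ), Real.exp (-(2 * Real.pi * b) * v)
        = Real.exp (-(2 * Real.pi * b) * |v|) := fun v hv => by rw [abs_of_pos hv]
    have h1 := (integrableOn_exp_mul_Ioi (neg_lt_zero.2 hc) 0).congr_fun h0 measurableSet_Ioi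
    refine ⟨?_, h1⟩
    rw [← integrableOn_Ici_iff_integrableOn_Ioi, ← neg_zero] at h1
    simpa only [abs_neg] using h1.comp_neg_Iic
  have hF : ∀ w : ℝ, FourierTransform.fourier f w = (poisson b w : ℂ) := by
    intro w
    rw [Real.fourier_real_eq_integral_exp_smul]
    have hint : Integrable
        (fun v : ℝ => Complex.exp (↑(-2 * Real.pi * v * w) * Complex.I) • f v) := by
      refine hfi.bdd_mul (c := 1) (by fun_prop) (ae_of_all _ fun v => ?_)
      rw [Complex.norm_exp_ofReal_mul_I]
    rw [← setIntegral_univ, ← Set.Iic_union_Ioi (a := 0),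
      setIntegral_union (Set.Iic_disjoint_Ioi le_rfl) measurableSet_Ioi hint.integrableOn
      hint.integrableOn, ← neg_zero, ← integral_comp_neg_Ioi, neg_zero]
    have e1 : ∫ v in Set.Ioi (0 : ℝ),
        Complex.exp (↑(-2 * Real.pi * (-v) * w) * Complex.I) • f (-v)
        = ∫ v in Set.Ioi (0 : ℝ),
          Complex.exp ((-(2 * Real.pi * b) + 2 * Real.pi * w * Complex.I : ℂ) * v) := by
      refine setIntegral_congr_fun measurableSet_Ioi fun v hv => ?_
      have hv : 0 < v := hv
      simp only [hf, abs_neg, abs_of_pos hv, smul_eq_mul]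
      rw [Complex.ofReal_exp, ← Complex.exp_add]
      congr 1; push_cast; ring
    have e2 : ∫ v in Set.Ioi (0 : ℝ),
        Complex.exp (↑(-2 * Real.pi * v * w) * Complex.I) • f v
        = ∫ v in Set.Ioi (0 : ℝ),
          Complex.exp ((-(2 * Real.pi * b) - 2 * Real.pi * w * Complex.I : ℂ) * v) := by
      refine setIntegral_congr_fun measurableSet_Ioi fun v hv => ?_
      have hv : 0 < v := hv
      simp only [hf, abs_of_pos hv, smul_eq_mul]
      rw [Complex.ofReal_exp, ← Complex.exp_add]
      congr 1; push_cast; ring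
    rw [e1, e2, integral_exp_mul_complex_Ioi (by simpa using hc),
      integral_exp_mul_complex_Ioi (by simpa using hc)]
    simp only [Complex.ofReal_zero, mul_zero, Complex.exp_zero, poisson]
    have hπ' : (Real.pi : ℂ) ≠ 0 := by exact_mod_cast Real.pi_ne_zero
    have h1 : (b : ℂ) + w * Complex.I ≠ 0 := by
      intro h; have := congrArg Complex.re h; simp at this; exact hb.ne' this
    have h2 : (b : ℂ) - w * Complex.I ≠ 0 := by
      intro h; have := congrArg Complex.re h; simp at this; exact hb.ne' this
    have h3 : (w : ℂ) ^ 2 + b ^ 2 = (b + w * Complex.I) * (b - w * Complex.I) := by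
      ring_nf; rw [Complex.I_sq]; ring
    push_cast
    rw [h3, show (-(2 * Real.pi * b) + 2 * Real.pi * w * Complex.I : ℂ)
      = -(2 * Real.pi * (b - w * Complex.I)) by ring,
      show (-(2 * Real.pi * b) - 2 * Real.pi * w * Complex.I : ℂ)
      = -(2 * Real.pi * (b + w * Complex.I)) by ring, neg_div_neg_eq, neg_div_neg_eq]
    field_simp
    ring
  have hFi : Integrable (FourierTransform.fourier f) := by
    rw [show FourierTransform.fourier f = fun w => (poisson b w : ℂ) from funext hF]
    exact (integrable_poisson hb).ofReal
  have hinv := hfi.fourierInv_fourier_eq hFi (v := -ξ / (2 * Real.pi)) hfc.continuousAt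
  rw [Real.fourierInv_eq'] at hinv
  have e3 : f (-ξ / (2 * Real.pi)) = Real.exp (-b * |ξ|) := by
    simp only [hf]
    congr 2
    rw [abs_div, abs_neg, abs_of_pos (show 0 < 2 * Real.pi by positivity)]
    field_simp
  rw [← e3, ← hinv]
  congr 1; ext s
  rw [hF, smul_eq_mul, mul_comm]
  congr 2
  have hπ' : (Real.pi : ℂ) ≠ 0 := by exact_mod_cast Real.pi_ne_zero
  simp
  field_simp

lemma integral_poisson {b : ℝ} (hb : 0 < b) : ∫ s, poisson b s = 1 := by
  have h := integral_poisson_mul_cexp hb 0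
  simp only [Complex.ofReal_zero, mul_zero, neg_zero, Complex.exp_zero, mul_one, abs_zero,
    Real.exp_zero, Complex.ofReal_one] at h
  rw [integral_complex_ofReal] at h
  exact_mod_cast h

lemma integrable_halfFourier_mul_poisson (ht : 0 < t) (n : ℕ) (x : ℝ) {b : ℝ} (hb : 0 < b) :
    Integrable fun s : ℝ => halfFourier t n ((x - s : ℝ) : ℂ) * poisson b s := by
  refine ((integrable_poisson hb).ofReal (𝕜 := ℂ)).bdd_mul (c := halfMoment t n)
    ?_ (ae_of_all _ fun s => norm_halfFourier_le ht n (by simp))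
  exact ((continuous_halfFourier ht n).comp (by fun_prop)).aestronglyMeasurable

/-- The values of `F_n` in the upper half plane are the Poisson integrals of those on the line. -/
lemma integral_halfFourier_mul_poisson (ht : 0 < t) (n : ℕ) (x : ℝ) {b : ℝ} (hb : 0 < b) :
    ∫ s, halfFourier t n ((x - s : ℝ) : ℂ) * poisson b s
      = halfFourier t n (x + b * Complex.I) := by
  set m : ℝ → ℂ := fun ξ => (ξ : ℂ) ^ n * Complex.exp (Complex.I * x * ξ - t * ξ ^ 2) with hm
  have e1 : ∀ s : ℝ, halfFourier t n ((x - s : ℝ) : ℂ) * poisson b s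
      = (1 / Real.pi) * ∫ ξ in Set.Ioi (0 : ℝ),
        m ξ * ((poisson b s : ℂ) * Complex.exp (-(Complex.I * s * ξ))) := by
    intro s
    rw [halfFourier, mul_assoc, ← integral_mul_const]
    congr 2; ext ξ
    have : Complex.exp (Complex.I * ((x - s : ℝ) : ℂ) * ξ - t * ξ ^ 2)
        = Complex.exp (Complex.I * x * ξ - t * ξ ^ 2) * Complex.exp (-(Complex.I * s * ξ)) := by
      rw [← Complex.exp_add]; congr 1; push_cast; ring
    rw [this]; simp only [hm]; ring
  simp_rw [e1]
  rw [integral_const_mul, integral_integral_swap, halfFourier]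
  · congr 1
    refine setIntegral_congr_fun measurableSet_Ioi fun ξ hξ => ?_
    have hξ : 0 < ξ := hξ
    rw [integral_const_mul, integral_poisson_mul_cexp hb, abs_of_pos hξ, Complex.ofReal_exp]
    simp only [hm]
    rw [mul_assoc, ← Complex.exp_add]
    congr 2
    push_cast
    linear_combination -b * ξ * Complex.I_sq
  · have i1 : Integrable m (volume.restrict (Set.Ioi 0)) := integrableOn_halfFourier ht n x
    have i2 := ((integrable_poisson hb).ofReal (𝕜 := ℂ)).mul_prod i1
    refine (i2.bdd_mul (c := 1) (f := fun p : ℝ × ℝ => Complex.exp (-(Complex.I * p.1 * p.2)))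
      (by fun_prop) (ae_of_all _ fun p => ?_)).congr (ae_of_all _ fun p => ?_)
    · rw [Complex.norm_exp]; simp
    · simp only [Function.uncurry]
      change _ * ((poisson b p.1 : ℂ) * _) = _
      ring

end

/-! ### The Green matrix in closed form -/

lemma hasDerivAt_log_norm {a b : ℝ} (h : a ^ 2 + b ^ 2 ≠ 0) :
    HasDerivAt (fun s : ℝ => -(1 / (2 * Real.pi)) * Real.log (√(s ^ 2 + b ^ 2)))
      (-(1 / 2) * conjPoisson b a) a := by
  have e : (fun s : ℝ => -(1 / (2 * Real.pi)) * Real.log (√(s ^ 2 + b ^ 2)))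
      = fun s : ℝ => -(1 / (4 * Real.pi)) * Real.log (s ^ 2 + b ^ 2) := by
    ext s
    rw [Real.log_sqrt (by positivity)]
    ring
  rw [e]
  have h1 : HasDerivAt (fun s : ℝ => s ^ 2 + b ^ 2) (2 * a) a := by
    simpa using (hasDerivAt_pow 2 a).add_const (b ^ 2)
  refine ((h1.log h).const_mul _).congr_deriv ?_
  have := Real.pi_pos
  rw [conjPoisson]
  field_simp
  ring

lemma hasDerivAt_laplaceE_fst {a b : ℝ} (h : a ^ 2 + b ^ 2 ≠ 0) :
    HasDerivAt (fun s => laplaceE (s, b)) (-(1 / 2) * conjPoisson b a) a :=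
  hasDerivAt_log_norm h

lemma hasDerivAt_laplaceE_snd {a b : ℝ} (h : a ^ 2 + b ^ 2 ≠ 0) :
    HasDerivAt (fun s => laplaceE (a, s)) (-(1 / 2) * poisson b a) b := by
  have h' := hasDerivAt_log_norm (a := b) (b := a) (by rwa [add_comm])
  have e : conjPoisson a b = poisson b a := by rw [conjPoisson, poisson, add_comm]
  rw [e] at h'
  simpa only [laplaceE, add_comm (a ^ 2)] using h'

section
variable {t : ℝ}

/-- The heat kernel of the half plane with the Dirichlet condition. -/
noncomputable def dirichletHeat (t : ℝ) (x z : ℝ × ℝ) : ℝ :=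
  gauss t (x.1 - z.1) * (gauss t (x.2 - z.2) - gauss t (x.2 + z.2))

/-- The convolution `∫_0^{x₂} F_n(x₁ - z₁ + i(x₂ - w)) Γ₁(w + z₂) dw` over the strip below `x`,
where `Γ₁` is the heat kernel of the line. -/
noncomputable def stripIntegral (t : ℝ) (n : ℕ) (x z : ℝ × ℝ) : ℂ :=
  ∫ w in (0 : ℝ)..x.2,
    halfFourier t n ((x.1 - z.1 : ℝ) + (x.2 - w : ℝ) * Complex.I) * gauss t (w + z.2)

lemma integral_laplaceE_mul_heatKernel (ht : 0 < t) (x z : ℝ × ℝ) {w₂ : ℝ} (hw : w₂ < x.2) :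
    (∫ w₁ : ℝ, pderiv 0 laplaceE (x - (w₁, w₂)) * heatKernel ((w₁, w₂) - refl z) t)
        = -(1 / 2) * (halfFourier t 0 ((x.1 - z.1 : ℝ) + (x.2 - w₂ : ℝ) * Complex.I)
          * gauss t (w₂ + z.2)).im ∧
    (∫ w₁ : ℝ, pderiv 1 laplaceE (x - (w₁, w₂)) * heatKernel ((w₁, w₂) - refl z) t)
        = -(1 / 2) * (halfFourier t 0 ((x.1 - z.1 : ℝ) + (x.2 - w₂ : ℝ) * Complex.I)
          * gauss t (w₂ + z.2)).re := by
  have hb : 0 < x.2 - w₂ := sub_pos.2 hw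
  set b := x.2 - w₂ with hbdef
  have hint := integrable_mul_cauchyKernel (integrable_gauss ht) (x.1 - z.1) hb
  have hval := integral_gauss_mul_cauchyKernel ht (x.1 - z.1) hb
  have hne : ∀ s : ℝ, s ^ 2 + b ^ 2 ≠ 0 := fun s => by positivity
  have hheat : ∀ w₁ : ℝ, heatKernel ((w₁, w₂) - refl z) t
      = gauss t (x.1 - z.1 - (x.1 - w₁)) * gauss t (w₂ + z.2) := by
    intro w₁
    rw [heatKernel_eq ht]
    simp [refl]
  have h0 : ∀ w₁ : ℝ, pderiv 0 laplaceE (x - (w₁, w₂)) * heatKernel ((w₁, w₂) - refl z) t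
      = (fun s : ℝ => -(1 / 2) * gauss t (w₂ + z.2) *
        ((gauss t (x.1 - z.1 - s) : ℂ) * cauchyKernel (s + b * Complex.I)).im) (x.1 - w₁) := by
    intro w₁
    simp only [Complex.im_ofReal_mul, cauchyKernel_im]
    rw [hheat]
    have : pderiv 0 laplaceE (x - (w₁, w₂)) = -(1 / 2) * conjPoisson b (x.1 - w₁) :=
      (hasDerivAt_laplaceE_fst (hne (x.1 - w₁))).deriv
    rw [this]; ring
  have h1 : ∀ w₁ : ℝ, pderiv 1 laplaceE (x - (w₁, w₂)) * heatKernel ((w₁, w₂) - refl z) t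
      = (fun s : ℝ => -(1 / 2) * gauss t (w₂ + z.2) *
        ((gauss t (x.1 - z.1 - s) : ℂ) * cauchyKernel (s + b * Complex.I)).re) (x.1 - w₁) := by
    intro w₁
    simp only [Complex.re_ofReal_mul, cauchyKernel_re]
    rw [hheat]
    have : pderiv 1 laplaceE (x - (w₁, w₂)) = -(1 / 2) * poisson b (x.1 - w₁) :=
      (hasDerivAt_laplaceE_snd (hne (x.1 - w₁))).deriv
    rw [this]; ring
  have him := integral_im hint
  have hre := integral_re hint
  simp only [RCLike.im_to_complex, RCLike.re_to_complex] at him hre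
  constructor
  · simp_rw [h0]
    rw [integral_sub_left_eq_self (fun s : ℝ => -(1 / 2) * gauss t (w₂ + z.2) *
        ((gauss t (x.1 - z.1 - s) : ℂ) * cauchyKernel (s + b * Complex.I)).im) volume x.1,
      integral_const_mul, him, hval, Complex.im_mul_ofReal]
    ring
  · simp_rw [h1]
    rw [integral_sub_left_eq_self (fun s : ℝ => -(1 / 2) * gauss t (w₂ + z.2) *
        ((gauss t (x.1 - z.1 - s) : ℂ) * cauchyKernel (s + b * Complex.I)).re) volume x.1,
      integral_const_mul, hre, hval, Complex.re_mul_ofReal]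
    ring

lemma continuous_stripIntegrand (ht : 0 < t) (n : ℕ) (x z : ℝ × ℝ) :
    Continuous fun w : ℝ =>
      halfFourier t n ((x.1 - z.1 : ℝ) + (x.2 - w : ℝ) * Complex.I) * gauss t (w + z.2) := by
  have h1 := continuous_halfFourier ht n
  have h2 := continuous_gauss t
  fun_prop

lemma continuous_stripIntegral (ht : 0 < t) (n : ℕ) (x : ℝ × ℝ) :
    Continuous (stripIntegral t n x) := by
  have h1 := continuous_halfFourier ht n
  have h2 := continuous_gauss t
  unfold stripIntegral
  refine intervalIntegral.continuous_parametric_intervalIntegral_of_continuous' ?_ _ _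
  simp only [Function.uncurry_def]
  fun_prop

/-- The strip integrals in the Green matrix. The inner integral is a convolution of the heat kernel
with `-Q/2` or `-P/2`, except on the null set `w₂ = x₂`. -/
lemma strip_eq (ht : 0 < t) (x z : ℝ × ℝ) (hx : 0 < x.2) :
    (∫ w₂ in (0 : ℝ)..x.2, ∫ w₁ : ℝ,
      pderiv 0 laplaceE (x - (w₁, w₂)) * heatKernel ((w₁, w₂) - refl z) t)
        = -(1 / 2) * (stripIntegral t 0 x z).im ∧
    (∫ w₂ in (0 : ℝ)..x.2, ∫ w₁ : ℝ,
      pderiv 1 laplaceE (x - (w₁, w₂)) * heatKernel ((w₁, w₂) - refl z) t)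
        = -(1 / 2) * (stripIntegral t 0 x z).re := by
  have hint : IntervalIntegrable (fun w : ℝ =>
      halfFourier t 0 ((x.1 - z.1 : ℝ) + (x.2 - w : ℝ) * Complex.I) * gauss t (w + z.2))
      volume 0 x.2 := (continuous_stripIntegrand ht 0 x z).intervalIntegrable _ _
  have him := Complex.imCLM.intervalIntegral_comp_comm hint
  have hre := Complex.reCLM.intervalIntegral_comp_comm hint
  simp only [Complex.imCLM_apply, Complex.reCLM_apply] at him hre
  unfold stripIntegral
  rw [← him, ← hre, ← intervalIntegral.integral_const_mul, ← intervalIntegral.integral_const_mul]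
  have hae : ∀ᵐ w : ℝ, w ≠ x.2 := by simp [ae_iff]
  constructor
  · refine intervalIntegral.integral_congr_ae ?_
    filter_upwards [hae] with w hw hwm
    rw [Set.uIoc_of_le hx.le] at hwm
    exact (integral_laplaceE_mul_heatKernel ht x z (lt_of_le_of_ne hwm.2 hw)).1
  · refine intervalIntegral.integral_congr_ae ?_
    filter_upwards [hae] with w hw hwm
    rw [Set.uIoc_of_le hx.le] at hwm
    exact (integral_laplaceE_mul_heatKernel ht x z (lt_of_le_of_ne hwm.2 hw)).2

lemma hasDerivAt_stripIntegral_fst (ht : 0 < t) (n : ℕ) (x z : ℝ × ℝ) (hx : 0 ≤ x.2) :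
    HasDerivAt (fun s => stripIntegral t n (s, x.2) z)
      (Complex.I * stripIntegral t (n + 1) x z) x.1 := by
  have h := (intervalIntegral.hasDerivAt_integral_of_dominated_loc_of_deriv_le
    (μ := volume) (a := 0) (b := x.2) (x₀ := x.1) (s := Set.univ)
    (F := fun (s : ℝ) w => halfFourier t n ((s - z.1 : ℝ) + (x.2 - w : ℝ) * Complex.I)
      * gauss t (w + z.2))
    (F' := fun (s : ℝ) w => Complex.I * (halfFourier t (n + 1)
      ((s - z.1 : ℝ) + (x.2 - w : ℝ) * Complex.I) * gauss t (w + z.2)))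
    (bound := fun _ => halfMoment t (n + 1) * (√(4 * Real.pi * t))⁻¹)
    univ_mem (Eventually.of_forall fun s =>
      (continuous_stripIntegrand ht n (s, x.2) z).aestronglyMeasurable)
    ((continuous_stripIntegrand ht n x z).intervalIntegrable _ _)
    ((continuous_stripIntegrand ht (n + 1) x z).const_mul _).aestronglyMeasurable
    ?_ (by simp) ?_).2
  · refine h.congr_deriv ?_
    rw [intervalIntegral.integral_const_mul]; rfl
  · refine ae_of_all _ fun w hw s _ => ?_
    rw [Set.uIoc_of_le hx] at hw
    rw [norm_mul, Complex.norm_I, one_mul, norm_mul, Complex.norm_real,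
      Real.norm_of_nonneg (gauss_nonneg t _)]
    exact mul_le_mul (norm_halfFourier_le ht _ (by simpa using hw.2)) (gauss_le ht _)
      (gauss_nonneg t _) (halfMoment_nonneg _ _)
  · refine ae_of_all _ fun w _ s _ => ?_
    have h := (hasDerivAt_halfFourier_re ht n (s - z.1) (x.2 - w)).comp_sub_const s z.1
    simpa only [mul_assoc] using h.mul_const (gauss t (w + z.2) : ℂ)

/-- The derivative of a convolution over `[0, s]` in `s`. -/
lemma hasDerivAt_convolution {f f' g : ℝ → ℂ} (hf : ∀ s, HasDerivAt f (f' s) s)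
    (hf' : Continuous f') (hg : Continuous g) (s₀ : ℝ) :
    HasDerivAt (fun s : ℝ => ∫ w in (0 : ℝ)..s, f (s - w) * g w)
      (f 0 * g s₀ + ∫ w in (0 : ℝ)..s₀, f' (s₀ - w) * g w) s₀ := by
  have hfc : Continuous f := continuous_iff_continuousAt.2 fun s => (hf s).continuousAt
  have hc : ∀ s, Continuous fun w => f (s - w) * g w := fun s => by fun_prop
  have hsplit : (fun s : ℝ => ∫ w in (0 : ℝ)..s, f (s - w) * g w)
      = fun s => (∫ w in s₀..s, f (s - w) * g w) + ∫ w in (0 : ℝ)..s₀, f (s - w) * g w := by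
    ext s
    rw [add_comm, intervalIntegral.integral_add_adjacent_intervals
      ((hc s).intervalIntegrable _ _) ((hc s).intervalIntegrable _ _)]
  rw [hsplit]
  refine HasDerivAt.add ?_ ?_
  · -- near the moving endpoint only the value of the integrand at the endpoint matters
    rw [hasDerivAt_iff_isLittleO, Asymptotics.isLittleO_iff]
    intro ε hε
    have hcont : ContinuousAt (fun p : ℝ × ℝ => f (p.1 - p.2) * g p.2) (s₀, s₀) := by fun_prop
    have hev := Metric.continuousAt_iff.1 hcont ε hε
    obtain ⟨δ, hδ, hev⟩ := hev
    filter_upwards [Metric.ball_mem_nhds s₀ hδ] with s hs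
    have e : (∫ w in s₀..s, f (s - w) * g w) - (∫ w in s₀..s₀, f (s₀ - w) * g w)
        - (s - s₀) • (f 0 * g s₀) = ∫ w in s₀..s, (f (s - w) * g w - f 0 * g s₀) := by
      rw [intervalIntegral.integral_sub ((hc s).intervalIntegrable _ _) (by simp)]
      simp only [intervalIntegral.integral_same, intervalIntegral.integral_const, sub_zero]
    rw [e]
    refine intervalIntegral.norm_integral_le_of_norm_le_const fun w hw => ?_
    have hw' : |w - s₀| ≤ |s - s₀| := Set.abs_sub_left_of_mem_uIcc (Set.uIoc_subset_uIcc hw)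
    have hs' : |s - s₀| < δ := by simpa [Real.dist_eq] using hs
    have := hev (x := (s, w)) (by
      rw [Prod.dist_eq, max_lt_iff, Real.dist_eq, Real.dist_eq]
      exact ⟨hs', hw'.trans_lt hs'⟩)
    simp only [sub_self, dist_eq_norm] at this
    exact this.le
  · obtain ⟨K, hK⟩ := (isCompact_Icc (a := -(|s₀| + 1)) (b := |s₀| + 1)).exists_bound_of_continuousOn
      hf'.continuousOn
    refine (intervalIntegral.hasDerivAt_integral_of_dominated_loc_of_deriv_le
      (μ := volume) (x₀ := s₀) (s := Metric.ball s₀ 1)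
      (F := fun s w => f (s - w) * g w) (F' := fun s w => f' (s - w) * g w)
      (bound := fun w => K * ‖g w‖) (Metric.ball_mem_nhds s₀ one_pos)
      (Eventually.of_forall fun s => (hc s).aestronglyMeasurable)
      ((hc s₀).intervalIntegrable _ _)
      (by fun_prop) ?_ ?_ ?_).2
    · refine ae_of_all _ fun w hw s hs => ?_
      rw [norm_mul]
      refine mul_le_mul_of_nonneg_right (hK _ ?_) (norm_nonneg _)
      have hs' : |s - s₀| < 1 := by simpa [Real.dist_eq] using hs
      have hw' : |w - s₀| ≤ |0 - s₀| :=
        (abs_sub_comm _ _).trans_le ((Set.abs_sub_right_of_mem_uIcc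
          (Set.uIoc_subset_uIcc hw)).trans_eq (abs_sub_comm _ _))
      rw [zero_sub, abs_neg] at hw'
      have : |s - w| ≤ |s₀| + 1 := by
        have := abs_sub_le s s₀ w
        rw [abs_sub_comm s₀ w] at this
        linarith
      exact abs_le.1 this
    · exact ((hg.norm).const_mul K).intervalIntegrable _ _
    · exact ae_of_all _ fun w _ s _ => ((hf (s - w)).comp_sub_const s w).mul_const (g w)

lemma hasDerivAt_stripIntegral_snd (ht : 0 < t) (n : ℕ) (x z : ℝ × ℝ) :
    HasDerivAt (fun s => stripIntegral t n (x.1, s) z)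
      (halfFourier t n ((x.1 - z.1 : ℝ) : ℂ) * gauss t (x.2 + z.2)
        - stripIntegral t (n + 1) x z) x.2 := by
  have hc := continuous_halfFourier ht (n + 1)
  have hg := continuous_gauss t
  have h := hasDerivAt_convolution
    (f := fun b : ℝ => halfFourier t n ((x.1 - z.1 : ℝ) + b * Complex.I))
    (g := fun w => (gauss t (w + z.2) : ℂ))
    (fun s => hasDerivAt_halfFourier_im ht n (x.1 - z.1) s) (by fun_prop) (by fun_prop) x.2
  refine h.congr_deriv ?_
  simp only [neg_mul, intervalIntegral.integral_neg, Complex.ofReal_zero, zero_mul, add_zero,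
    sub_eq_add_neg (halfFourier t n _ * _)]
  rfl

lemma hasDerivAt_re {f : ℝ → ℂ} {f' : ℂ} {s : ℝ} (h : HasDerivAt f f' s) :
    HasDerivAt (fun s => (f s).re) f'.re s :=
  (Complex.reCLM.hasFDerivAt.comp_hasDerivAt s h)

lemma hasDerivAt_im {f : ℝ → ℂ} {f' : ℂ} {s : ℝ} (h : HasDerivAt f f' s) :
    HasDerivAt (fun s => (f s).im) f'.im s :=
  (Complex.imCLM.hasFDerivAt.comp_hasDerivAt s h)

lemma heatKernel_sub_heatKernel (ht : 0 < t) (x z : ℝ × ℝ) :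
    heatKernel (x - z) t - heatKernel (x - refl z) t = dirichletHeat t x z := by
  rw [heatKernel_eq ht, heatKernel_eq ht, dirichletHeat]
  simp [refl, mul_sub]

/-- The first column of the Green matrix. -/
noncomputable def greenCol (t : ℝ) (i : Fin 2) (x z : ℝ × ℝ) : ℝ :=
  ![dirichletHeat t x z + 2 * (stripIntegral t 1 x z).re, -2 * (stripIntegral t 1 x z).im] i

lemma stokesGreen_zero (ht : 0 < t) (i : Fin 2) (x z : ℝ × ℝ) (hx : 0 < x.2) :
    stokesGreen i 0 x z t = greenCol t i x z := by
  have hd := hasDerivAt_stripIntegral_fst ht 0 x z hx.le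
  rw [stokesGreen, heatKernel_sub_heatKernel ht, greenCol]
  fin_cases i
  · have e : pderiv 0 (fun x' : ℝ × ℝ => ∫ w₂ in (0 : ℝ)..x'.2, ∫ w₁ : ℝ,
        pderiv 0 laplaceE (x' - (w₁, w₂)) * heatKernel ((w₁, w₂) - refl z) t) x
        = -(1 / 2) * (stripIntegral t 1 x z).re := by
      have h := (hasDerivAt_im hd).const_mul (-(1 / 2))
      simp only [Complex.I_mul_im, zero_add] at h
      refine Eq.trans ?_ h.deriv
      simp only [pderiv]
      congr 1; ext s
      exact (strip_eq ht (s, x.2) z hx).1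
    simp only [Fin.zero_eta, Fin.isValue, e, Matrix.cons_val_zero, if_true]
    norm_num; ring
  · have e : pderiv 0 (fun x' : ℝ × ℝ => ∫ w₂ in (0 : ℝ)..x'.2, ∫ w₁ : ℝ,
        pderiv 1 laplaceE (x' - (w₁, w₂)) * heatKernel ((w₁, w₂) - refl z) t) x
        = (1 / 2) * (stripIntegral t 1 x z).im := by
      have h := (hasDerivAt_re hd).const_mul (-(1 / 2))
      simp only [Complex.I_mul_re, zero_add] at h
      refine Eq.trans ?_ (h.deriv.trans (by ring))
      simp only [pderiv]
      congr 1; ext s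
      exact (strip_eq ht (s, x.2) z hx).2
    simp only [Fin.mk_one, Fin.isValue, e, Matrix.cons_val_one]
    norm_num; ring

lemma stokesGreen_one (ht : 0 < t) (i : Fin 2) (x z : ℝ × ℝ) :
    stokesGreen i 1 x z t = if i = 1 then dirichletHeat t x z else 0 := by
  rw [stokesGreen, heatKernel_sub_heatKernel ht, if_pos rfl, sub_self, mul_zero, zero_mul, sub_zero]
  split_ifs <;> simp

end

/-! ### Domination of the Green matrix and its derivatives -/

/-- The weight `1 / ((1 + z₁²)(1 + z₂²))`, which dominates the Green matrix and its derivatives in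
`z`, locally uniformly in `x`, and against which the velocity is integrable. -/
noncomputable def weight (z : ℝ × ℝ) : ℝ := (1 + z.1 ^ 2)⁻¹ * (1 + z.2 ^ 2)⁻¹

lemma weight_pos (z : ℝ × ℝ) : 0 < weight z := by unfold weight; positivity

lemma continuous_weight : Continuous weight := by
  unfold weight
  refine Continuous.mul (Continuous.inv₀ (by fun_prop) fun z => ?_)
    (Continuous.inv₀ (by fun_prop) fun z => ?_) <;> positivity

lemma measurableSet_halfPlane : MeasurableSet halfPlane :=
  measurableSet_lt measurable_const measurable_snd

lemma div_one_add_sq_sub_le {K R x z : ℝ} (hK : 0 ≤ K) (hx : |x| ≤ R) :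
    K / (1 + (x - z) ^ 2) ≤ 2 * (1 + R ^ 2) * K * (1 + z ^ 2)⁻¹ := by
  rw [← div_eq_mul_inv, div_le_div_iff₀ (by positivity) (by positivity)]
  have h1 : x ^ 2 ≤ R ^ 2 := sq_le_sq' (abs_le.1 hx).1 (abs_le.1 hx).2
  have h2 : 1 + z ^ 2 ≤ 2 * (1 + R ^ 2) * (1 + (x - z) ^ 2) := by
    nlinarith [sq_nonneg (2 * x - z), mul_nonneg (sq_nonneg R) (sq_nonneg (x - z))]
  nlinarith [mul_le_mul_of_nonneg_left h2 hK]

section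
variable {t : ℝ}

lemma exists_gauss_shift_le (ht : 0 < t) (R : ℝ) : ∃ K, 0 ≤ K ∧ ∀ x z : ℝ, |x| ≤ R →
    |gauss t (x - z)| ≤ K * (1 + z ^ 2)⁻¹ ∧ |gauss t (x + z)| ≤ K * (1 + z ^ 2)⁻¹ ∧
    |gaussDeriv t (x - z)| ≤ K * (1 + z ^ 2)⁻¹ ∧ |gaussDeriv t (x + z)| ≤ K * (1 + z ^ 2)⁻¹ := by
  obtain ⟨K, hK, h⟩ := exists_gauss_le ht
  refine ⟨2 * (1 + R ^ 2) * K, by positivity, fun x z hx => ?_⟩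
  have hm := div_one_add_sq_sub_le (z := z) hK hx
  have hp := div_one_add_sq_sub_le (z := -z) hK hx
  rw [sub_neg_eq_add, neg_sq] at hp
  exact ⟨(h _).1.trans hm, (h _).1.trans hp, (h _).2.trans hm, (h _).2.trans hp⟩

lemma exists_halfFourier_shift_le (ht : 0 < t) (R : ℝ) {n : ℕ} (hn : n ≠ 0) :
    ∃ K, 0 ≤ K ∧ ∀ x z b : ℝ, |x| ≤ R → 0 ≤ b →
      ‖halfFourier t n ((x - z : ℝ) + b * Complex.I)‖ ≤ K * (1 + z ^ 2)⁻¹ := by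
  obtain ⟨K, hK, h⟩ := exists_norm_halfFourier_le ht hn
  exact ⟨2 * (1 + R ^ 2) * K, by positivity, fun x z b hx hb =>
    (h _ _ hb).trans (div_one_add_sq_sub_le hK hx)⟩

lemma exists_stripIntegral_le (ht : 0 < t) (R : ℝ) {n : ℕ} (hn : n ≠ 0) :
    ∃ K, 0 ≤ K ∧ ∀ x z : ℝ × ℝ, |x.1| ≤ R → 0 ≤ x.2 → x.2 ≤ R → 0 ≤ z.2 →
      ‖stripIntegral t n x z‖ ≤ K * weight z := by
  obtain ⟨K, hK, h⟩ := exists_halfFourier_shift_le ht R hn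
  obtain ⟨L, hL, h'⟩ := exists_gauss_shift_le ht 0
  refine ⟨K * L * |R|, by positivity, fun x z hx1 hx2 hxR hz => ?_⟩
  have hb := intervalIntegral.norm_integral_le_of_norm_le_const (a := 0) (b := x.2)
    (C := (K * (1 + z.1 ^ 2)⁻¹) * (L * (1 + z.2 ^ 2)⁻¹))
    (f := fun w => halfFourier t n ((x.1 - z.1 : ℝ) + (x.2 - w : ℝ) * Complex.I)
      * gauss t (w + z.2)) (fun w hw => by
        rw [Set.uIoc_of_le hx2] at hw
        rw [norm_mul, Complex.norm_real]
        refine mul_le_mul (h _ _ _ hx1 (sub_nonneg.2 hw.2)) ?_ (norm_nonneg _) (by positivity)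
        rw [Real.norm_of_nonneg (gauss_nonneg t _)]
        refine (gauss_le_gauss ht (r := 0 + z.2) ?_).trans
          ((le_abs_self _).trans (h' 0 z.2 (by simp)).2.1)
        rw [zero_add, abs_of_nonneg hz, abs_of_nonneg (add_nonneg hw.1.le hz)]
        linarith [hw.1])
  refine hb.trans ?_
  rw [sub_zero, abs_of_nonneg hx2, weight]
  have hR : x.2 ≤ |R| := hxR.trans (le_abs_self R)
  calc K * (1 + z.1 ^ 2)⁻¹ * (L * (1 + z.2 ^ 2)⁻¹) * x.2
      ≤ K * (1 + z.1 ^ 2)⁻¹ * (L * (1 + z.2 ^ 2)⁻¹) * |R| := by gcongr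
    _ = _ := by ring

/-- The derivative of the Dirichlet heat kernel in `x₁`. -/
noncomputable def dirichletHeatFst (t : ℝ) (x z : ℝ × ℝ) : ℝ :=
  gaussDeriv t (x.1 - z.1) * (gauss t (x.2 - z.2) - gauss t (x.2 + z.2))

/-- The derivative of the Dirichlet heat kernel in `x₂`. -/
noncomputable def dirichletHeatSnd (t : ℝ) (x z : ℝ × ℝ) : ℝ :=
  gauss t (x.1 - z.1) * (gaussDeriv t (x.2 - z.2) - gaussDeriv t (x.2 + z.2))

/-- The derivative of `G₁₁` in `x₂`. -/
noncomputable def greenColSnd (t : ℝ) (x z : ℝ × ℝ) : ℝ :=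
  dirichletHeatSnd t x z + 2 * (halfFourier t 1 ((x.1 - z.1 : ℝ) : ℂ) * gauss t (x.2 + z.2)
    - stripIntegral t 2 x z).re

/-- The derivative of `G₂₁` in `x₁`. -/
noncomputable def greenColFst (t : ℝ) (x z : ℝ × ℝ) : ℝ := -2 * (stripIntegral t 2 x z).re

lemma hasDerivAt_dirichletHeat_fst (ht : 0 < t) (x z : ℝ × ℝ) :
    HasDerivAt (fun s => dirichletHeat t (s, x.2) z) (dirichletHeatFst t x z) x.1 :=
  ((hasDerivAt_gauss ht _).comp_sub_const x.1 z.1).mul_const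
    (gauss t (x.2 - z.2) - gauss t (x.2 + z.2))

lemma hasDerivAt_dirichletHeat_snd (ht : 0 < t) (x z : ℝ × ℝ) :
    HasDerivAt (fun s => dirichletHeat t (x.1, s) z) (dirichletHeatSnd t x z) x.2 :=
  (((hasDerivAt_gauss ht _).comp_sub_const x.2 z.2).sub
    ((hasDerivAt_gauss ht _).comp_add_const x.2 z.2)).const_mul (gauss t (x.1 - z.1))

lemma hasDerivAt_greenCol_snd (ht : 0 < t) (x z : ℝ × ℝ) :
    HasDerivAt (fun s => greenCol t 0 (x.1, s) z) (greenColSnd t x z) x.2 :=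
  (hasDerivAt_dirichletHeat_snd ht x z).add
    ((hasDerivAt_re (hasDerivAt_stripIntegral_snd ht 1 x z)).const_mul 2)

lemma hasDerivAt_greenCol_fst (ht : 0 < t) (x z : ℝ × ℝ) (hx : 0 ≤ x.2) :
    HasDerivAt (fun s => greenCol t 1 (s, x.2) z) (greenColFst t x z) x.1 := by
  have h := (hasDerivAt_im (hasDerivAt_stripIntegral_fst ht 1 x z hx)).const_mul (-2)
  rw [Complex.I_mul_im] at h
  exact h

lemma continuous_dirichletHeat (t : ℝ) (x : ℝ × ℝ) : Continuous (dirichletHeat t x) := by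
  have := continuous_gauss t
  unfold dirichletHeat; fun_prop

lemma continuous_dirichletHeatFst (t : ℝ) (x : ℝ × ℝ) : Continuous (dirichletHeatFst t x) := by
  have := continuous_gauss t
  have := continuous_gaussDeriv t
  unfold dirichletHeatFst; fun_prop

lemma continuous_dirichletHeatSnd (t : ℝ) (x : ℝ × ℝ) : Continuous (dirichletHeatSnd t x) := by
  have := continuous_gauss t
  have := continuous_gaussDeriv t
  unfold dirichletHeatSnd; fun_prop

lemma continuous_greenCol (ht : 0 < t) (i : Fin 2) (x : ℝ × ℝ) :
    Continuous (greenCol t i x) := by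
  have h1 := continuous_stripIntegral ht 1 x
  have h2 := continuous_dirichletHeat t x
  fin_cases i
  · exact h2.add ((Complex.continuous_re.comp h1).const_mul 2)
  · exact (Complex.continuous_im.comp h1).const_mul (-2)

lemma continuous_greenColSnd (ht : 0 < t) (x : ℝ × ℝ) : Continuous (greenColSnd t x) := by
  have h1 := continuous_stripIntegral ht 2 x
  have h2 := continuous_dirichletHeatSnd t x
  have h3 : Continuous fun z : ℝ × ℝ => halfFourier t 1 ((x.1 - z.1 : ℝ) : ℂ) :=
    (continuous_halfFourier ht 1).comp (by fun_prop)
  have h4 := continuous_gauss t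
  have h5 : Continuous fun z : ℝ × ℝ => ((gauss t (x.2 + z.2) : ℝ) : ℂ) := by fun_prop
  exact h2.add ((Complex.continuous_re.comp ((h3.mul h5).sub h1)).const_mul 2)

lemma continuous_greenColFst (ht : 0 < t) (x : ℝ × ℝ) : Continuous (greenColFst t x) :=
  (Complex.continuous_re.comp (continuous_stripIntegral ht 2 x)).const_mul (-2)

/-- Domination by the weight, uniformly for `x` in the bounded set `|x₁| ≤ R`, `0 ≤ x₂ ≤ R`. -/
lemma exists_green_le (ht : 0 < t) (R : ℝ) :
    ∃ K, 0 ≤ K ∧ ∀ x z : ℝ × ℝ, |x.1| ≤ R → 0 ≤ x.2 → x.2 ≤ R → 0 ≤ z.2 →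
      |dirichletHeat t x z| ≤ K * weight z ∧ |dirichletHeatFst t x z| ≤ K * weight z ∧
      (∀ i, |greenCol t i x z| ≤ K * weight z) ∧ |greenColSnd t x z| ≤ K * weight z ∧
      |greenColFst t x z| ≤ K * weight z := by
  obtain ⟨A, hA, hg⟩ := exists_gauss_shift_le ht R
  obtain ⟨B, hB, hs1⟩ := exists_stripIntegral_le ht R (n := 1) one_ne_zero
  obtain ⟨C, hC, hs2⟩ := exists_stripIntegral_le ht R (n := 2) two_ne_zero
  obtain ⟨D, hD, hF⟩ := exists_halfFourier_shift_le ht R (n := 1) one_ne_zero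
  refine ⟨2 * A * A + 2 * B + 2 * C + 2 * D * A, by positivity, fun x z hx1 hx2 hxR hz => ?_⟩
  have hx2' : |x.2| ≤ R := by rwa [abs_of_nonneg hx2]
  obtain ⟨g1, -, g1', -⟩ := hg x.1 z.1 hx1
  obtain ⟨g2, g3, g2', g3'⟩ := hg x.2 z.2 hx2'
  have s1 := hs1 x z hx1 hx2 hxR hz
  have s2 := hs2 x z hx1 hx2 hxR hz
  have f1 := hF x.1 z.1 0 hx1 le_rfl
  rw [Complex.ofReal_zero, zero_mul, add_zero] at f1
  have hw := (weight_pos z).le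
  set p := (1 + z.1 ^ 2)⁻¹ with hp
  set q := (1 + z.2 ^ 2)⁻¹ with hq
  have hwpq : weight z = p * q := rfl
  have hp0 : 0 ≤ p := by positivity
  have hq0 : 0 ≤ q := by positivity
  have hprod : ∀ {a b c : ℝ}, |a| ≤ A * p → |b| ≤ A * q → |c| ≤ A * q →
      |a * (b - c)| ≤ 2 * A * A * weight z := by
    intro a b c ha hb hc
    rw [abs_mul, hwpq]
    calc |a| * |b - c| ≤ (A * p) * (A * q + A * q) := by
          refine mul_le_mul ha ((abs_sub _ _).trans (add_le_add hb hc)) (abs_nonneg _)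
            (by positivity)
      _ = _ := by ring
  have h1 := hprod g1 g2 g3
  have h2 := hprod g1' g2 g3
  have h3 := hprod g1 g2' g3'
  have r1 : |(stripIntegral t 1 x z).re| ≤ B * weight z := (Complex.abs_re_le_norm _).trans s1
  have i1 : |(stripIntegral t 1 x z).im| ≤ B * weight z := (Complex.abs_im_le_norm _).trans s1
  have r2 : |(stripIntegral t 2 x z).re| ≤ C * weight z := (Complex.abs_re_le_norm _).trans s2
  have r3 : |(halfFourier t 1 ((x.1 - z.1 : ℝ) : ℂ) * gauss t (x.2 + z.2)).re|
      ≤ D * A * weight z := by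
    refine (Complex.abs_re_le_norm _).trans ?_
    rw [norm_mul, Complex.norm_real, hwpq]
    calc _ ≤ (D * p) * (A * q) := mul_le_mul f1 g3 (abs_nonneg _) (by positivity)
      _ = _ := by ring
  have n1 : 0 ≤ A * A * weight z := by positivity
  have n2 : 0 ≤ B * weight z := by positivity
  have n3 : 0 ≤ C * weight z := by positivity
  have n4 : 0 ≤ D * A * weight z := by positivity
  refine ⟨?_, ?_, fun i => ?_, ?_, ?_⟩
  · unfold dirichletHeat; linarith
  · unfold dirichletHeatFst; linarith
  · fin_cases i
    · change |dirichletHeat t x z + 2 * _| ≤ _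
      unfold dirichletHeat
      refine (abs_add_le _ _).trans ?_
      rw [abs_mul 2, abs_two]; linarith
    · change |-2 * _| ≤ _
      rw [abs_mul, abs_neg, abs_two]; linarith
  · unfold greenColSnd dirichletHeatSnd
    rw [Complex.sub_re]
    refine (abs_add_le _ _).trans ?_
    rw [abs_mul 2, abs_two]
    have := abs_sub (halfFourier t 1 ((x.1 - z.1 : ℝ) : ℂ) * gauss t (x.2 + z.2)).re
      (stripIntegral t 2 x z).re
    linarith
  · unfold greenColFst
    rw [abs_mul, abs_neg, abs_two]; linarith

/-! ### The Stokes flow of a weighted integrable field and its vorticity -/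

lemma aestronglyMeasurable_of_weight {u : ℝ × ℝ → ℝ}
    (hu : IntegrableOn (fun z => weight z * u z) halfPlane) :
    AEStronglyMeasurable u (volume.restrict halfPlane) := by
  have h : Continuous fun z => (weight z)⁻¹ :=
    continuous_weight.inv₀ fun z => (weight_pos z).ne'
  refine (h.aestronglyMeasurable.mul hu.aestronglyMeasurable).congr (ae_of_all _ fun z => ?_)
  simp [(weight_pos z).ne']

lemma integrableOn_mul_of_le_weight {u k : ℝ × ℝ → ℝ} {K : ℝ}
    (hu : IntegrableOn (fun z => weight z * u z) halfPlane)
    (hk : Continuous k) (hkb : ∀ z ∈ halfPlane, |k z| ≤ K * weight z) :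
    IntegrableOn (fun z => k z * u z) halfPlane := by
  refine (hu.norm.const_mul K).mono'
    (hk.aestronglyMeasurable.mul (aestronglyMeasurable_of_weight hu)) ?_
  filter_upwards [ae_restrict_mem measurableSet_halfPlane] with z hz
  rw [norm_mul, norm_mul, Real.norm_eq_abs (weight z), abs_of_pos (weight_pos z), ← mul_assoc]
  exact mul_le_mul_of_nonneg_right (hkb z hz) (norm_nonneg _)

lemma hasDerivAt_integral_mul_of_le_weight {u : ℝ × ℝ → ℝ} {k k' : ℝ → ℝ × ℝ → ℝ} {K r s₀ : ℝ}
    (hr : 0 < r) (hu : IntegrableOn (fun z => weight z * u z) halfPlane)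
    (hk : ∀ s, Continuous (k s)) (hk' : Continuous (k' s₀))
    (hkb : ∀ z ∈ halfPlane, |k s₀ z| ≤ K * weight z)
    (hkb' : ∀ s ∈ Metric.ball s₀ r, ∀ z ∈ halfPlane, |k' s z| ≤ K * weight z)
    (hd : ∀ s ∈ Metric.ball s₀ r, ∀ z, HasDerivAt (fun s => k s z) (k' s z) s) :
    HasDerivAt (fun s => ∫ z in halfPlane, k s z * u z) (∫ z in halfPlane, k' s₀ z * u z) s₀ := by
  have hum := aestronglyMeasurable_of_weight hu
  refine (hasDerivAt_integral_of_dominated_loc_of_deriv_le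
    (F := fun s z => k s z * u z) (F' := fun s z => k' s z * u z)
    (bound := fun z => K * ‖weight z * u z‖) (Metric.ball_mem_nhds s₀ hr)
    (Eventually.of_forall fun s => (hk s).aestronglyMeasurable.mul hum)
    (integrableOn_mul_of_le_weight hu (hk s₀) hkb) (hk'.aestronglyMeasurable.mul hum)
    ?_ (hu.norm.const_mul K) ?_).2
  · filter_upwards [ae_restrict_mem measurableSet_halfPlane] with z hz s hs
    rw [norm_mul, norm_mul, Real.norm_eq_abs (weight z), abs_of_pos (weight_pos z), ← mul_assoc]
    exact mul_le_mul_of_nonneg_right (hkb' s hs z hz) (norm_nonneg _)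
  · exact ae_of_all _ fun z s hs => (hd s hs z).mul_const _

variable {u : ℝ × ℝ → Fin 2 → ℝ}

lemma integrableOn_stokesGreen_mul (ht : 0 < t)
    (hu : ∀ j, IntegrableOn (fun z => weight z * u z j) halfPlane) {x : ℝ × ℝ} (hx : 0 < x.2)
    (i j : Fin 2) : IntegrableOn (fun z => stokesGreen i j x z t * u z j) halfPlane := by
  obtain ⟨K, hK, h⟩ := exists_green_le ht (max |x.1| x.2)
  have h' := fun z (hz : z ∈ halfPlane) =>
    h x z (le_max_left _ _) hx.le (le_max_right _ _) (le_of_lt hz)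
  rcases Fin.exists_fin_two.1 ⟨j, rfl⟩ with rfl | rfl
  · simp_rw [stokesGreen_zero ht i x _ hx]
    exact integrableOn_mul_of_le_weight (hu 0) (continuous_greenCol ht i x)
      fun z hz => (h' z hz).2.2.1 i
  · simp_rw [stokesGreen_one ht i x]
    split_ifs
    · exact integrableOn_mul_of_le_weight (hu 1) (continuous_dirichletHeat t x)
        fun z hz => (h' z hz).1
    · simp

lemma stokes_zero_eq (ht : 0 < t) {x : ℝ × ℝ} (hx : 0 < x.2) :
    stokes t u x 0 = ∫ z in halfPlane, greenCol t 0 x z * u z 0 := by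
  simp [stokes, Fin.sum_univ_two, stokesGreen_zero ht 0 x _ hx, stokesGreen_one ht]

lemma stokes_one_eq (ht : 0 < t)
    (hu : ∀ j, IntegrableOn (fun z => weight z * u z j) halfPlane) {x : ℝ × ℝ} (hx : 0 < x.2) :
    stokes t u x 1 = (∫ z in halfPlane, greenCol t 1 x z * u z 0)
      + ∫ z in halfPlane, dirichletHeat t x z * u z 1 := by
  have h0 := integrableOn_stokesGreen_mul ht hu hx 1 0
  have h1 := integrableOn_stokesGreen_mul ht hu hx 1 1
  have e := integral_add h0 h1
  simpa [stokes, Fin.sum_univ_two, stokesGreen_zero ht 1 x _ hx, stokesGreen_one ht] using e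

lemma hasDerivAt_stokes_zero (ht : 0 < t)
    (hu : ∀ j, IntegrableOn (fun z => weight z * u z j) halfPlane) {x : ℝ × ℝ} (hx : 0 < x.2) :
    HasDerivAt (fun s => stokes t u (x.1, s) 0)
      (∫ z in halfPlane, greenColSnd t x z * u z 0) x.2 := by
  obtain ⟨K, hK, h⟩ := exists_green_le ht (max |x.1| (2 * x.2))
  have hball : ∀ s ∈ Metric.ball x.2 x.2, 0 < s ∧ s < 2 * x.2 := by
    intro s hs
    rw [Metric.mem_ball, Real.dist_eq, abs_lt] at hs
    constructor <;> linarith [hs.1, hs.2]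
  have hd := hasDerivAt_integral_mul_of_le_weight (k := fun s => greenCol t 0 (x.1, s))
    (k' := fun s => greenColSnd t (x.1, s)) (K := K) (s₀ := x.2) hx (hu 0)
    (fun s => continuous_greenCol ht 0 _) (continuous_greenColSnd ht _)
    (fun z hz => (h x z (le_max_left _ _) hx.le (le_max_of_le_right (by linarith))
      (le_of_lt hz)).2.2.1 0)
    (fun s hs z hz => (h (x.1, s) z (le_max_left _ _) (hball s hs).1.le
      (le_max_of_le_right (hball s hs).2.le) (le_of_lt hz)).2.2.2.1)
    (fun s _ z => hasDerivAt_greenCol_snd ht (x.1, s) z)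
  refine hd.congr_of_eventuallyEq ?_
  filter_upwards [Metric.ball_mem_nhds x.2 hx] with s hs
  exact stokes_zero_eq ht (x := (x.1, s)) (hball s hs).1

lemma hasDerivAt_stokes_one (ht : 0 < t)
    (hu : ∀ j, IntegrableOn (fun z => weight z * u z j) halfPlane) {x : ℝ × ℝ} (hx : 0 < x.2) :
    HasDerivAt (fun s => stokes t u (s, x.2) 1)
      ((∫ z in halfPlane, greenColFst t x z * u z 0)
        + ∫ z in halfPlane, dirichletHeatFst t x z * u z 1) x.1 := by
  obtain ⟨K, hK, h⟩ := exists_green_le ht (max (|x.1| + 1) x.2)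
  have hball : ∀ s ∈ Metric.ball x.1 1, |s| ≤ |x.1| + 1 := by
    intro s hs
    rw [Metric.mem_ball, Real.dist_eq] at hs
    have := abs_sub_abs_le_abs_sub s x.1
    linarith
  have hmem : x.1 ∈ Metric.ball x.1 1 := Metric.mem_ball_self one_pos
  have hb := fun s (hs : s ∈ Metric.ball x.1 1) z (hz : z ∈ halfPlane) =>
    h (s, x.2) z (le_max_of_le_left (hball s hs)) hx.le (le_max_right _ _) (le_of_lt hz)
  have hd1 := hasDerivAt_integral_mul_of_le_weight (k := fun s => greenCol t 1 (s, x.2))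
    (k' := fun s => greenColFst t (s, x.2)) (K := K) (s₀ := x.1) one_pos (hu 0)
    (fun s => continuous_greenCol ht 1 _) (continuous_greenColFst ht _)
    (fun z hz => (hb _ hmem z hz).2.2.1 1) (fun s hs z hz => (hb s hs z hz).2.2.2.2)
    (fun s _ z => hasDerivAt_greenCol_fst ht (s, x.2) z hx.le)
  have hd2 := hasDerivAt_integral_mul_of_le_weight (k := fun s => dirichletHeat t (s, x.2))
    (k' := fun s => dirichletHeatFst t (s, x.2)) (K := K) (s₀ := x.1) one_pos (hu 1)
    (fun s => continuous_dirichletHeat t _) (continuous_dirichletHeatFst t _)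
    (fun z hz => (hb _ hmem z hz).1) (fun s hs z hz => (hb s hs z hz).2.1)
    (fun s _ z => hasDerivAt_dirichletHeat_fst ht (s, x.2) z)
  refine (hd1.add hd2).congr_of_eventuallyEq (Eventually.of_forall fun s => ?_)
  exact stokes_one_eq ht hu (x := (s, x.2)) hx

/-- The kernel of `u ↦ -∇^⊥ · S(t) u`. The convolutions over the strip below `x` cancel, since
`F_n(a + ib)` is holomorphic in `a + ib`. -/
noncomputable def curlKernel (t : ℝ) (j : Fin 2) (x z : ℝ × ℝ) : ℝ :=
  ![-dirichletHeatSnd t x z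
      - 2 * ((halfFourier t 1 ((x.1 - z.1 : ℝ) : ℂ)).re * gauss t (x.2 + z.2)),
    dirichletHeatFst t x z] j

lemma curlKernel_zero (t : ℝ) (x z : ℝ × ℝ) :
    curlKernel t 0 x z = greenColFst t x z - greenColSnd t x z := by
  simp only [curlKernel, greenColFst, greenColSnd, Complex.sub_re, Complex.re_mul_ofReal,
    Matrix.cons_val_zero]
  ring

lemma exists_curlKernel_le (ht : 0 < t) {x : ℝ × ℝ} (hx : 0 < x.2) :
    ∃ K, 0 ≤ K ∧ ∀ z ∈ halfPlane, ∀ j, |curlKernel t j x z| ≤ K * weight z := by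
  obtain ⟨K, hK, h⟩ := exists_green_le ht (max |x.1| x.2)
  refine ⟨2 * K, by positivity, fun z hz j => ?_⟩
  obtain ⟨-, h1, -, h2, h3⟩ := h x z (le_max_left _ _) hx.le (le_max_right _ _) (le_of_lt hz)
  have hw := (weight_pos z).le
  have : 0 ≤ K * weight z := by positivity
  rcases Fin.exists_fin_two.1 ⟨j, rfl⟩ with rfl | rfl
  · rw [curlKernel_zero]
    exact (abs_sub _ _).trans (by linarith)
  · exact h1.trans (by linarith)

lemma continuous_curlKernel (ht : 0 < t) (j : Fin 2) (x : ℝ × ℝ) :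
    Continuous (curlKernel t j x) := by
  rcases Fin.exists_fin_two.1 ⟨j, rfl⟩ with rfl | rfl
  · exact ((continuous_greenColFst ht x).sub (continuous_greenColSnd ht x)).congr
      fun z => (curlKernel_zero t x z).symm
  · exact continuous_dirichletHeatFst t x

lemma neg_divPerp_stokes (ht : 0 < t)
    (hu : ∀ j, IntegrableOn (fun z => weight z * u z j) halfPlane) {x : ℝ × ℝ} (hx : 0 < x.2) :
    -divPerp (stokes t u) x = ∫ z in halfPlane, ∑ j, curlKernel t j x z * u z j := by
  have e0 : pderiv 1 (fun z => stokes t u z 0) x = ∫ z in halfPlane, greenColSnd t x z * u z 0 :=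
    (hasDerivAt_stokes_zero ht hu hx).deriv
  have e1 : pderiv 0 (fun z => stokes t u z 1) x = (∫ z in halfPlane, greenColFst t x z * u z 0)
      + ∫ z in halfPlane, dirichletHeatFst t x z * u z 1 := (hasDerivAt_stokes_one ht hu hx).deriv
  obtain ⟨K, hK, h⟩ := exists_green_le ht (max |x.1| x.2)
  have hb := fun z (hz : z ∈ halfPlane) =>
    h x z (le_max_left _ _) hx.le (le_max_right _ _) (le_of_lt hz)
  have i1 := integrableOn_mul_of_le_weight (hu 0) (continuous_greenColFst ht x)
    fun z hz => (hb z hz).2.2.2.2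
  have i2 := integrableOn_mul_of_le_weight (hu 0) (continuous_greenColSnd ht x)
    fun z hz => (hb z hz).2.2.2.1
  have i3 := integrableOn_mul_of_le_weight (hu 1) (continuous_dirichletHeatFst t x)
    fun z hz => (hb z hz).2.1
  rw [divPerp, e0, e1]
  have e : ∀ z, ∑ j, curlKernel t j x z * u z j = (greenColFst t x z * u z 0
      - greenColSnd t x z * u z 0) + dirichletHeatFst t x z * u z 1 := by
    intro z
    rw [Fin.sum_univ_two, curlKernel_zero, sub_mul]
    rfl
  simp_rw [e]
  have i12 : IntegrableOn (fun z => greenColFst t x z * u z 0 - greenColSnd t x z * u z 0)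
    halfPlane := i1.sub i2
  rw [integral_add i12 i3, integral_sub i1 i2]
  ring

end

/-! ### The Biot–Savart kernel -/

/-- The Biot–Savart kernel `∇^⊥_z D(z, y)` in closed form, for `z ≠ y`. -/
noncomputable def velKernel (z y : ℝ × ℝ) (i : Fin 2) : ℝ :=
  ![(1 / 2) * (poisson (z.2 + y.2) (z.1 - y.1) - poisson (z.2 - y.2) (z.1 - y.1)),
    (1 / 2) * (conjPoisson (z.2 - y.2) (z.1 - y.1) - conjPoisson (z.2 + y.2) (z.1 - y.1))] i

lemma gradPerp_greenD {z y : ℝ × ℝ} (hz : 0 < z.2) (hy : 0 ≤ y.2) (hzy : z ≠ y) (i : Fin 2) :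
    gradPerp (fun x' => greenD x' y) z i = velKernel z y i := by
  have h1 : (z.1 - y.1) ^ 2 + (z.2 - y.2) ^ 2 ≠ 0 := by
    intro h
    apply hzy
    ext <;> nlinarith [sq_nonneg (z.1 - y.1), sq_nonneg (z.2 - y.2)]
  have h2 : (z.1 - y.1) ^ 2 + (z.2 + y.2) ^ 2 ≠ 0 := by positivity
  have e : ∀ a b : ℝ, greenD (a, b) y
      = laplaceE (a - y.1, b - y.2) - laplaceE (a - y.1, b + y.2) := by
    intro a b
    simp [greenD, laplaceE, refl]
  rcases Fin.exists_fin_two.1 ⟨i, rfl⟩ with rfl | rfl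
  · have h := ((hasDerivAt_laplaceE_snd h1).comp_sub_const z.2 y.2).sub
      ((hasDerivAt_laplaceE_snd h2).comp_add_const z.2 y.2)
    have : pderiv 1 (fun x' => greenD x' y) z = _ := Eq.trans
      (by simp only [pderiv, e]; rfl) h.deriv
    simp only [gradPerp, velKernel, Matrix.cons_val_zero, this]
    ring
  · have h := ((hasDerivAt_laplaceE_fst h1).comp_sub_const z.1 y.1).sub
      ((hasDerivAt_laplaceE_fst h2).comp_sub_const z.1 y.1)
    have : pderiv 0 (fun x' => greenD x' y) z = _ := Eq.trans
      (by simp only [pderiv, e]; rfl) h.deriv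
    simp only [gradPerp, velKernel, Matrix.cons_val_one, this]
    ring_nf

lemma measurable_velKernel (i : Fin 2) :
    Measurable fun p : (ℝ × ℝ) × (ℝ × ℝ) => velKernel p.1 p.2 i := by
  rcases Fin.exists_fin_two.1 ⟨i, rfl⟩ with rfl | rfl
  · simp only [velKernel, Matrix.cons_val_zero, poisson]; fun_prop
  · simp only [velKernel, Matrix.cons_val_one, conjPoisson]; fun_prop

/-- The singularity `s^{-1/2}`, cut off to `0 < s ≤ 1`. -/
noncomputable def cutRoot (s : ℝ) : ℝ := (Set.Ioc 0 1).indicator (fun s => s ^ (-(1 / 2) : ℝ)) s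

lemma cutRoot_nonneg (s : ℝ) : 0 ≤ cutRoot s :=
  Set.indicator_nonneg (fun _ hs => Real.rpow_nonneg hs.1.le _) s

lemma integrable_cutRoot : Integrable cutRoot := by
  refine IntegrableOn.integrable_indicator ?_ measurableSet_Ioc
  rw [← intervalIntegrable_iff_integrableOn_Ioc_of_le zero_le_one]
  exact intervalIntegral.intervalIntegrable_rpow' (by norm_num)

/-- A majorant of `(1 + s²)⁻¹ |s - c|^{-1/2}` whose integral does not depend on `c`. -/
noncomputable def rootMajorant (c s : ℝ) : ℝ :=
  (1 + s ^ 2)⁻¹ + (cutRoot (s - c) + cutRoot (c - s))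

lemma integrable_rootMajorant (c : ℝ) : Integrable (rootMajorant c) :=
  integrable_inv_one_add_sq.add
    ((integrable_cutRoot.comp_sub_right c).add (integrable_cutRoot.comp_sub_left c))

lemma integral_rootMajorant (c : ℝ) :
    ∫ s, rootMajorant c s = Real.pi + ((∫ s, cutRoot s) + ∫ s, cutRoot s) := by
  have h2 := integrable_cutRoot.comp_sub_right c
  have h3 := integrable_cutRoot.comp_sub_left c
  have h23 : Integrable fun s => cutRoot (s - c) + cutRoot (c - s) := h2.add h3
  unfold rootMajorant
  rw [integral_add integrable_inv_one_add_sq h23, integral_add h2 h3,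
    integral_univ_inv_one_add_sq, integral_sub_right_eq_self, integral_sub_left_eq_self]

lemma le_rootMajorant {c s : ℝ} (h : s ≠ c) :
    (1 + s ^ 2)⁻¹ * |s - c| ^ (-(1 / 2) : ℝ) ≤ rootMajorant c s := by
  have hw0 : 0 ≤ (1 + s ^ 2)⁻¹ := by positivity
  have hw1 : (1 + s ^ 2)⁻¹ ≤ 1 := inv_le_one_of_one_le₀ (by nlinarith [sq_nonneg s])
  have hpos : 0 < |s - c| := abs_pos.2 (sub_ne_zero.2 h)
  unfold rootMajorant
  rcases le_or_gt |s - c| 1 with h1 | h1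
  · have hr : |s - c| ^ (-(1 / 2) : ℝ) ≤ cutRoot (s - c) + cutRoot (c - s) := by
      have key : ∀ r : ℝ, r ∈ Set.Ioc (0 : ℝ) 1 → cutRoot r = r ^ (-(1 / 2) : ℝ) :=
        fun r hr => Set.indicator_of_mem hr _
      rcases lt_or_gt_of_ne (sub_ne_zero.2 h) with hs | hs
      · rw [abs_of_neg hs] at h1 hpos ⊢
        rw [neg_sub] at h1 hpos ⊢
        rw [← key _ ⟨hpos, h1⟩]
        linarith [cutRoot_nonneg (s - c)]
      · rw [abs_of_pos hs] at h1 ⊢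
        rw [← key _ ⟨hs, h1⟩]
        linarith [cutRoot_nonneg (c - s)]
    have hr0 : 0 ≤ |s - c| ^ (-(1 / 2) : ℝ) := Real.rpow_nonneg hpos.le _
    nlinarith
  · have hr : |s - c| ^ (-(1 / 2) : ℝ) ≤ 1 :=
      Real.rpow_le_one_of_one_le_of_nonpos h1.le (by norm_num)
    have := cutRoot_nonneg (s - c)
    have := cutRoot_nonneg (c - s)
    nlinarith

lemma abs_div_le_rpow {a b : ℝ} (ha : a ≠ 0) (hb : b ≠ 0) :
    |b| / (Real.pi * (a ^ 2 + b ^ 2)) ≤ |a| ^ (-(1 / 2) : ℝ) * |b| ^ (-(1 / 2) : ℝ) := by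
  have ha' : 0 < |a| := abs_pos.2 ha
  have hb' : 0 < |b| := abs_pos.2 hb
  have hN : 0 < a ^ 2 + b ^ 2 := by positivity
  rw [← Real.mul_rpow ha'.le hb'.le, Real.rpow_neg (by positivity), ← Real.sqrt_eq_rpow,
    div_le_iff₀ (by positivity), inv_mul_eq_div, le_div_iff₀ (Real.sqrt_pos.2 (by positivity))]
  have h1 : |b| * √(|a| * |b|) ≤ a ^ 2 + b ^ 2 := by
    rw [← abs_of_nonneg (Real.sqrt_nonneg (|a| * |b|)), ← abs_abs b, ← abs_mul]
    refine abs_le_of_sq_le_sq ?_ hN.le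
    rw [mul_pow, Real.sq_sqrt (by positivity), sq_abs, abs_abs]
    have h2 : |a| * |b| ≤ a ^ 2 + b ^ 2 := by
      nlinarith [sq_nonneg (|a| - |b|), sq_abs a, sq_abs b]
    calc b ^ 2 * (|a| * |b|) ≤ (a ^ 2 + b ^ 2) * (a ^ 2 + b ^ 2) := by
          gcongr
          nlinarith [sq_nonneg a]
      _ = (a ^ 2 + b ^ 2) ^ 2 := by ring
  nlinarith [Real.pi_gt_three]

lemma abs_poisson_le {a b : ℝ} (ha : a ≠ 0) (hb : b ≠ 0) :
    |poisson b a| ≤ |a| ^ (-(1 / 2) : ℝ) * |b| ^ (-(1 / 2) : ℝ) := by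
  have := Real.pi_pos
  rw [poisson, abs_div, abs_of_nonneg (show 0 ≤ Real.pi * (a ^ 2 + b ^ 2) by positivity)]
  exact abs_div_le_rpow ha hb

lemma abs_conjPoisson_le {a b : ℝ} (ha : a ≠ 0) (hb : b ≠ 0) :
    |conjPoisson b a| ≤ |a| ^ (-(1 / 2) : ℝ) * |b| ^ (-(1 / 2) : ℝ) := by
  have := Real.pi_pos
  rw [conjPoisson, abs_div, abs_of_nonneg (show 0 ≤ Real.pi * (a ^ 2 + b ^ 2) by positivity),
    mul_comm (|a| ^ _), add_comm]
  exact abs_div_le_rpow hb ha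

/-- The singularity of the kernel is of order `|z - y|⁻¹`, which the product of the one-dimensional
singularities `|z_j - y_j|^{-1/2}` dominates. The reflected point `y*` is farther from `z` than `y`. -/
lemma abs_velKernel_le {z y : ℝ × ℝ} (hz : 0 < z.2) (hy : 0 ≤ y.2) (h1 : z.1 ≠ y.1)
    (h2 : z.2 ≠ y.2) (i : Fin 2) :
    |velKernel z y i| ≤ |z.1 - y.1| ^ (-(1 / 2) : ℝ) * |z.2 - y.2| ^ (-(1 / 2) : ℝ) := by
  have h1' := sub_ne_zero.2 h1
  have h2' := sub_ne_zero.2 h2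
  have h3 : z.2 + y.2 ≠ 0 := by positivity
  have hmono : |z.2 + y.2| ^ (-(1 / 2) : ℝ) ≤ |z.2 - y.2| ^ (-(1 / 2) : ℝ) := by
    refine Real.rpow_le_rpow_of_nonpos (abs_pos.2 h2') ?_ (by norm_num)
    rw [abs_of_pos (by positivity : 0 < z.2 + y.2), abs_le]
    constructor <;> linarith
  have hr : 0 ≤ |z.1 - y.1| ^ (-(1 / 2) : ℝ) := Real.rpow_nonneg (abs_nonneg _) _
  have hm := mul_le_mul_of_nonneg_left hmono hr
  have p1 := abs_poisson_le h1' h2'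
  have p2 := (abs_poisson_le h1' h3).trans hm
  have q1 := abs_conjPoisson_le h1' h2'
  have q2 := (abs_conjPoisson_le h1' h3).trans hm
  rcases Fin.exists_fin_two.1 ⟨i, rfl⟩ with rfl | rfl
  · change |1 / 2 * (_ - _)| ≤ _
    rw [abs_mul, abs_of_pos (by norm_num : (0 : ℝ) < 1 / 2)]
    have := abs_sub (poisson (z.2 + y.2) (z.1 - y.1)) (poisson (z.2 - y.2) (z.1 - y.1))
    linarith
  · change |1 / 2 * (_ - _)| ≤ _
    rw [abs_mul, abs_of_pos (by norm_num : (0 : ℝ) < 1 / 2)]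
    have := abs_sub (conjPoisson (z.2 - y.2) (z.1 - y.1)) (conjPoisson (z.2 + y.2) (z.1 - y.1))
    linarith

lemma ae_fst_ne_and_snd_ne (y : ℝ × ℝ) : ∀ᵐ z : ℝ × ℝ, z.1 ≠ y.1 ∧ z.2 ≠ y.2 := by
  have h1 : ∀ᵐ s : ℝ, s ≠ y.1 := by simp [ae_iff]
  have h2 : ∀ᵐ s : ℝ, s ≠ y.2 := by simp [ae_iff]
  exact (Measure.quasiMeasurePreserving_fst.ae h1).and (Measure.quasiMeasurePreserving_snd.ae h2)

lemma ae_norm_weight_mul_velKernel_le {y : ℝ × ℝ} (hy : 0 ≤ y.2) (i : Fin 2) :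
    ∀ᵐ z ∂(volume.restrict halfPlane),
      ‖weight z * velKernel z y i‖ ≤ rootMajorant y.1 z.1 * rootMajorant y.2 z.2 := by
  filter_upwards [ae_restrict_of_ae (ae_fst_ne_and_snd_ne y),
    ae_restrict_mem measurableSet_halfPlane] with z hne hz
  have h := abs_velKernel_le hz hy hne.1 hne.2 i
  rw [norm_mul, Real.norm_eq_abs, Real.norm_eq_abs, abs_of_pos (weight_pos z), weight]
  have h1 := le_rootMajorant hne.1
  have h2 := le_rootMajorant hne.2
  have hr : 0 ≤ |z.1 - y.1| ^ (-(1 / 2) : ℝ) := Real.rpow_nonneg (abs_nonneg _) _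
  have hr' : 0 ≤ |z.2 - y.2| ^ (-(1 / 2) : ℝ) := Real.rpow_nonneg (abs_nonneg _) _
  calc _ ≤ (1 + z.1 ^ 2)⁻¹ * (1 + z.2 ^ 2)⁻¹ *
        (|z.1 - y.1| ^ (-(1 / 2) : ℝ) * |z.2 - y.2| ^ (-(1 / 2) : ℝ)) := by gcongr
    _ = ((1 + z.1 ^ 2)⁻¹ * |z.1 - y.1| ^ (-(1 / 2) : ℝ))
        * ((1 + z.2 ^ 2)⁻¹ * |z.2 - y.2| ^ (-(1 / 2) : ℝ)) := by ring
    _ ≤ _ := mul_le_mul h1 h2 (by positivity) (le_trans (by positivity) h1)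

lemma integrableOn_weight_mul_velKernel {y : ℝ × ℝ} (hy : 0 ≤ y.2) (i : Fin 2) :
    IntegrableOn (fun z => weight z * velKernel z y i) halfPlane := by
  refine Integrable.mono' (g := fun z : ℝ × ℝ => rootMajorant y.1 z.1 * rootMajorant y.2 z.2)
    ?_ ?_ (ae_norm_weight_mul_velKernel_le hy i)
  · exact ((integrable_rootMajorant y.1).mul_prod (integrable_rootMajorant y.2)).integrableOn
  · refine (continuous_weight.measurable.mul ?_).aestronglyMeasurable
    exact (measurable_velKernel i).comp (measurable_id.prodMk measurable_const)

lemma integral_norm_weight_mul_velKernel_le {y : ℝ × ℝ} (hy : 0 ≤ y.2) (i : Fin 2) :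
    ∫ z in halfPlane, ‖weight z * velKernel z y i‖
      ≤ (Real.pi + ((∫ s, cutRoot s) + ∫ s, cutRoot s)) ^ 2 := by
  have hint := (integrable_rootMajorant y.1).mul_prod (integrable_rootMajorant y.2)
  have hnn : ∀ c s, 0 ≤ rootMajorant c s := fun c s => by
    have := cutRoot_nonneg (s - c)
    have := cutRoot_nonneg (c - s)
    unfold rootMajorant; positivity
  calc _ ≤ ∫ z in halfPlane, rootMajorant y.1 z.1 * rootMajorant y.2 z.2 :=
        integral_mono_ae (integrableOn_weight_mul_velKernel hy i).norm hint.integrableOn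
          (ae_norm_weight_mul_velKernel_le hy i)
    _ ≤ ∫ z : ℝ × ℝ, rootMajorant y.1 z.1 * rootMajorant y.2 z.2 :=
        setIntegral_le_integral hint (ae_of_all _ fun z => mul_nonneg (hnn _ _) (hnn _ _))
    _ = _ := by
        rw [Measure.volume_eq_prod, integral_prod_mul, integral_rootMajorant,
          integral_rootMajorant]
        ring

section
variable (ν : Measure closedHalfPlane) [IsFiniteMeasure ν]

lemma measurable_weight_mul_velKernel (i : Fin 2) :
    Measurable fun p : (ℝ × ℝ) × closedHalfPlane => weight p.1 * velKernel p.1 p.2 i :=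
  (continuous_weight.measurable.comp measurable_fst).mul
    ((measurable_velKernel i).comp
      (measurable_fst.prodMk (measurable_subtype_coe.comp measurable_snd)))

lemma integrable_weight_mul_velKernel_prod (i : Fin 2) :
    Integrable (fun p : (ℝ × ℝ) × closedHalfPlane => weight p.1 * velKernel p.1 p.2 i)
      ((volume.restrict halfPlane).prod ν) := by
  have hm := (measurable_weight_mul_velKernel i).aestronglyMeasurable
    (μ := (volume.restrict halfPlane).prod ν)
  rw [integrable_prod_iff' hm]
  refine ⟨ae_of_all _ fun y => integrableOn_weight_mul_velKernel y.2 i, ?_⟩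
  refine Integrable.of_bound (C := (Real.pi + ((∫ s, cutRoot s) + ∫ s, cutRoot s)) ^ 2)
    hm.norm.prod_swap.integral_prod_right' (ae_of_all _ fun y => ?_)
  rw [Real.norm_of_nonneg (integral_nonneg fun z => norm_nonneg _)]
  exact integral_norm_weight_mul_velKernel_le y.2 i

/-- The velocity field of a finite measure, with the Biot–Savart kernel in closed form. -/
noncomputable def velocity (z : ℝ × ℝ) (i : Fin 2) : ℝ := ∫ y, velKernel z y i ∂ν

lemma ae_integrable_velKernel (i : Fin 2) :
    ∀ᵐ z ∂(volume.restrict halfPlane),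
      Integrable (fun y : closedHalfPlane => velKernel z y i) ν := by
  filter_upwards [(integrable_weight_mul_velKernel_prod ν i).prod_right_ae] with z hz
  refine (hz.const_mul (weight z)⁻¹).congr (ae_of_all _ fun y => ?_)
  simp [(weight_pos z).ne']

lemma integrableOn_weight_mul_velocity (i : Fin 2) :
    IntegrableOn (fun z => weight z * velocity ν z i) halfPlane := by
  refine (integrable_weight_mul_velKernel_prod ν i).integral_prod_left.congr
    (ae_of_all _ fun z => ?_)
  simp only [velocity, integral_const_mul]

/-- For almost every `z` the measure has no atom at `z`, so the kernel on the diagonal is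
irrelevant. -/
lemma ae_gradPerp_eq : ∀ᵐ z ∂(volume.restrict halfPlane), ∀ᵐ y : closedHalfPlane ∂ν, ∀ i : Fin 2,
    gradPerp (fun x' => greenD x' y) z i = velKernel z y i := by
  have h : ∀ᵐ z : ℝ × ℝ ∂(volume.restrict halfPlane), ∀ᵐ y : closedHalfPlane ∂ν, z ≠ (y : ℝ × ℝ) := by
    rw [Measure.ae_ae_comm]
    · refine ae_of_all _ fun y => ae_restrict_of_ae ?_
      filter_upwards [ae_fst_ne_and_snd_ne y] with z hz h
      exact hz.1 (congrArg Prod.fst h)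
    · exact (measurableSet_eq_fun measurable_fst
        (measurable_subtype_coe.comp measurable_snd)).compl
  filter_upwards [h, ae_restrict_mem measurableSet_halfPlane] with z hz hzm
  filter_upwards [hz] with y hy i
  exact gradPerp_greenD hzm y.2 hy i

/-- The action of the vorticity kernel on the velocity of a finite measure, by Fubini. -/
lemma integral_curlKernel_mul_velocity {t : ℝ} (ht : 0 < t) {x : ℝ × ℝ} (hx : 0 < x.2) :
    (∀ y : closedHalfPlane,
      IntegrableOn (fun z => ∑ j, curlKernel t j x z * velKernel z y j) halfPlane) ∧
    ∫ z in halfPlane, ∑ j, curlKernel t j x z * velocity ν z j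
      = ∫ y, (∫ z in halfPlane, ∑ j, curlKernel t j x z * velKernel z y j) ∂ν := by
  obtain ⟨K, hK, hb⟩ := exists_curlKernel_le ht hx
  have hsingle : ∀ y : closedHalfPlane,
      IntegrableOn (fun z => ∑ j, curlKernel t j x z * velKernel z y j) halfPlane := by
    intro y
    refine integrable_finsetSum _ fun j _ => ?_
    exact integrableOn_mul_of_le_weight (integrableOn_weight_mul_velKernel y.2 j)
      (continuous_curlKernel ht j x) fun z hz => hb z hz j
  have hprod : Integrable (fun p : (ℝ × ℝ) × closedHalfPlane =>
      ∑ j, curlKernel t j x p.1 * velKernel p.1 p.2 j) ((volume.restrict halfPlane).prod ν) := by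
    refine integrable_finsetSum _ fun j _ => ?_
    refine ((integrable_weight_mul_velKernel_prod ν j).norm.const_mul K).mono' ?_ ?_
    · refine (((continuous_curlKernel ht j x).measurable.comp measurable_fst).mul
        ((measurable_velKernel j).comp
        (measurable_fst.prodMk (measurable_subtype_coe.comp measurable_snd)))).aestronglyMeasurable
    · have hmem : ∀ᵐ p ∂((volume.restrict halfPlane).prod ν), p.1 ∈ halfPlane :=
        Measure.quasiMeasurePreserving_fst.ae (ae_restrict_mem measurableSet_halfPlane)
      filter_upwards [hmem] with p hp
      rw [norm_mul, norm_mul, Real.norm_eq_abs (weight p.1), abs_of_pos (weight_pos _), ← mul_assoc]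
      exact mul_le_mul_of_nonneg_right (hb p.1 hp j) (norm_nonneg _)
  refine ⟨hsingle, ?_⟩
  rw [← integral_integral_swap hprod]
  refine integral_congr_ae ?_
  filter_upwards [ae_integrable_velKernel ν 0, ae_integrable_velKernel ν 1] with z h0 h1
  simp only [Fin.sum_univ_two, velocity]
  rw [integral_add (h0.const_mul _) (h1.const_mul _), integral_const_mul, integral_const_mul]

end

/-! ### The kernel of the vorticity -/

/-- The kernel of `T(t)`:
`Γ(x - y) - Γ(x - y*) + 2 ∫_0^{y₂} Γ₁'(x₂ + s) (P_{y₂ - s} * Γ₁)(x₁ - y₁) ds`, where `Γ₁` is the heat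
kernel of the line and `P` is the Poisson kernel. -/
noncomputable def vorticityKernel (t : ℝ) (x y : ℝ × ℝ) : ℝ :=
  dirichletHeat t x y + 2 * ∫ s in (0 : ℝ)..y.2,
    gaussDeriv t (x.2 + s) * (halfFourier t 0 ((x.1 - y.1 : ℝ) + (y.2 - s : ℝ) * Complex.I)).re

section
variable {t : ℝ}

lemma integral_gauss_mul_poisson (ht : 0 < t) (a : ℝ) {b : ℝ} (hb : 0 < b) :
    Integrable (fun s => gauss t (a - s) * poisson b s) ∧
    ∫ s, gauss t (a - s) * poisson b s = (halfFourier t 0 (a + b * Complex.I)).re := by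
  have hi := integrable_mul_cauchyKernel (integrable_gauss ht) a hb
  have hre := integral_re hi
  have hi' := hi.re
  simp only [RCLike.re_to_complex, Complex.re_ofReal_mul, cauchyKernel_re,
    integral_gauss_mul_cauchyKernel ht a hb] at hre hi'
  exact ⟨hi', hre⟩

lemma integral_gaussDeriv_mul_conjPoisson (ht : 0 < t) (a : ℝ) {b : ℝ} (hb : 0 < b) :
    Integrable (fun s => gaussDeriv t (a - s) * conjPoisson b s) ∧
    ∫ s, gaussDeriv t (a - s) * conjPoisson b s = (halfFourier t 1 (a + b * Complex.I)).re := by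
  have hi := integrable_mul_cauchyKernel (integrable_gaussDeriv ht) a hb
  have him := integral_im hi
  have hi' := hi.im
  simp only [RCLike.im_to_complex, Complex.im_ofReal_mul, cauchyKernel_im,
    integral_gaussDeriv_mul_cauchyKernel ht a hb, Complex.I_mul_im] at him hi'
  exact ⟨hi', him⟩

lemma integral_re_halfFourier_mul_poisson (ht : 0 < t) (n : ℕ) (a : ℝ) {b : ℝ} (hb : 0 < b) :
    Integrable (fun s => (halfFourier t n ((a - s : ℝ) : ℂ)).re * poisson b s) ∧
    ∫ s, (halfFourier t n ((a - s : ℝ) : ℂ)).re * poisson b s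
      = (halfFourier t n (a + b * Complex.I)).re := by
  have hi := integrable_halfFourier_mul_poisson ht n a hb
  have hre := integral_re hi
  have hi' := hi.re
  simp only [RCLike.re_to_complex, Complex.re_mul_ofReal,
    integral_halfFourier_mul_poisson ht n a hb] at hre hi'
  exact ⟨hi', hre⟩

/-- The tangential integral at the height `z₂ = y₂ + εb`, where `b > 0` and `ε = ±1`. -/
lemma integral_curlKernel_mul_velKernel_line (ht : 0 < t) (x y : ℝ × ℝ) {ε b z₂ : ℝ}
    (hε : ε = 1 ∨ ε = -1) (hb : 0 < b) (hz : z₂ - y.2 = ε * b) (hzy : 0 < z₂ + y.2) :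
    ∫ z₁ : ℝ, ∑ j, curlKernel t j x (z₁, z₂) * velKernel (z₁, z₂) y j
      = (gaussDeriv t (x.2 + z₂) - gaussDeriv t (x.2 - z₂)) *
          (1 / 2 * ((halfFourier t 0 ((x.1 - y.1 : ℝ) + (z₂ + y.2 : ℝ) * Complex.I)).re
            - ε * (halfFourier t 0 ((x.1 - y.1 : ℝ) + b * Complex.I)).re))
        - gauss t (x.2 + z₂) *
          ((halfFourier t 1 ((x.1 - y.1 : ℝ) + (z₂ + y.2 : ℝ) * Complex.I)).re
            - ε * (halfFourier t 1 ((x.1 - y.1 : ℝ) + b * Complex.I)).re)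
        + (gauss t (x.2 - z₂) - gauss t (x.2 + z₂)) *
          (1 / 2 * ((halfFourier t 1 ((x.1 - y.1 : ℝ) + b * Complex.I)).re
            - (halfFourier t 1 ((x.1 - y.1 : ℝ) + (z₂ + y.2 : ℝ) * Complex.I)).re)) := by
  set a : ℝ := x.1 - y.1 with ha
  have hP : ∀ s, poisson (ε * b) s = ε * poisson b s := by
    intro s
    rcases hε with rfl | rfl
    · simp
    · simp [poisson, neg_div]
  have hQ : ∀ s, conjPoisson (ε * b) s = conjPoisson b s := by
    intro s
    rcases hε with rfl | rfl
    · simp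
    · simp [conjPoisson]
  obtain ⟨i1, e1⟩ := integral_gauss_mul_poisson ht a hzy
  obtain ⟨i2, e2⟩ := integral_gauss_mul_poisson ht a hb
  obtain ⟨i3, e3⟩ := integral_re_halfFourier_mul_poisson ht 1 a hzy
  obtain ⟨i4, e4⟩ := integral_re_halfFourier_mul_poisson ht 1 a hb
  obtain ⟨i5, e5⟩ := integral_gaussDeriv_mul_conjPoisson ht a hb
  obtain ⟨i6, e6⟩ := integral_gaussDeriv_mul_conjPoisson ht a hzy
  set c1 := gaussDeriv t (x.2 + z₂) - gaussDeriv t (x.2 - z₂) with hc1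
  set c2 := gauss t (x.2 + z₂) with hc2
  set c3 := gauss t (x.2 - z₂) - gauss t (x.2 + z₂) with hc3
  have hT : ∀ z₁ : ℝ, ∑ j, curlKernel t j x (z₁, z₂) * velKernel (z₁, z₂) y j
      = (fun s : ℝ =>
        (c1 * (1 / 2 * (gauss t (a - s) * poisson (z₂ + y.2) s
            - ε * (gauss t (a - s) * poisson b s)))
          - c2 * ((halfFourier t 1 ((a - s : ℝ) : ℂ)).re * poisson (z₂ + y.2) s
            - ε * ((halfFourier t 1 ((a - s : ℝ) : ℂ)).re * poisson b s)))
          + c3 * (1 / 2 * (gaussDeriv t (a - s) * conjPoisson b s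
            - gaussDeriv t (a - s) * conjPoisson (z₂ + y.2) s))) (z₁ - y.1) := by
    intro z₁
    have e : x.1 - y.1 - (z₁ - y.1) = x.1 - z₁ := by ring
    simp only [Fin.sum_univ_two, curlKernel, velKernel, Matrix.cons_val_zero, Matrix.cons_val_one,
      hz, hP, hQ, dirichletHeatSnd, dirichletHeatFst, ha, e, hc1, hc2, hc3]
    ring
  simp_rw [hT]
  rw [integral_sub_right_eq_self (fun s : ℝ =>
        (c1 * (1 / 2 * (gauss t (a - s) * poisson (z₂ + y.2) s
            - ε * (gauss t (a - s) * poisson b s)))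
          - c2 * ((halfFourier t 1 ((a - s : ℝ) : ℂ)).re * poisson (z₂ + y.2) s
            - ε * ((halfFourier t 1 ((a - s : ℝ) : ℂ)).re * poisson b s)))
          + c3 * (1 / 2 * (gaussDeriv t (a - s) * conjPoisson b s
            - gaussDeriv t (a - s) * conjPoisson (z₂ + y.2) s))) y.1]
  have j1 : Integrable fun s => gauss t (a - s) * poisson (z₂ + y.2) s
      - ε * (gauss t (a - s) * poisson b s) := i1.sub (i2.const_mul ε)
  have j2 : Integrable fun s => (halfFourier t 1 ((a - s : ℝ) : ℂ)).re * poisson (z₂ + y.2) s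
      - ε * ((halfFourier t 1 ((a - s : ℝ) : ℂ)).re * poisson b s) := i3.sub (i4.const_mul ε)
  have j3 : Integrable fun s => gaussDeriv t (a - s) * conjPoisson b s
      - gaussDeriv t (a - s) * conjPoisson (z₂ + y.2) s := i5.sub i6
  have k1 := (j1.const_mul (1 / 2)).const_mul c1
  have k2 := j2.const_mul c2
  have k3 := (j3.const_mul (1 / 2)).const_mul c3
  have k12 : Integrable fun s => c1 * (1 / 2 * (gauss t (a - s) * poisson (z₂ + y.2) s
            - ε * (gauss t (a - s) * poisson b s)))
          - c2 * ((halfFourier t 1 ((a - s : ℝ) : ℂ)).re * poisson (z₂ + y.2) s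
            - ε * ((halfFourier t 1 ((a - s : ℝ) : ℂ)).re * poisson b s)) := k1.sub k2
  rw [integral_add k12 k3, integral_sub k1 k2]
  simp only [integral_const_mul]
  rw [integral_sub i1 (i2.const_mul ε), integral_sub i3 (i4.const_mul ε), integral_sub i5 i6,
    integral_const_mul, integral_const_mul, e1, e2, e3, e4, e5, e6]

lemma volume_restrict_halfPlane :
    (volume : Measure (ℝ × ℝ)).restrict halfPlane
      = (volume : Measure ℝ).prod ((volume : Measure ℝ).restrict (Set.Ioi 0)) := by
  have e : halfPlane = Set.univ ×ˢ Set.Ioi (0 : ℝ) := by ext z; simp [halfPlane]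
  rw [e, Measure.volume_eq_prod, ← Measure.prod_restrict, Measure.restrict_univ]

/-- Integrating the vorticity kernel of the Stokes semigroup against the Biot–Savart kernel.
After the tangential integration the integrand is, below and above the height of `y`, a derivative
in `z₂` up to the integrand of the second term of the vorticity kernel. -/
lemma integral_curlKernel_mul_velKernel (ht : 0 < t) {x y : ℝ × ℝ} (hy : 0 ≤ y.2)
    (hint : IntegrableOn (fun z => ∑ j, curlKernel t j x z * velKernel z y j) halfPlane) :
    ∫ z in halfPlane, ∑ j, curlKernel t j x z * velKernel z y j = vorticityKernel t x y := by
  rcases hy.eq_or_lt with hy0 | hy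
  · simp [velKernel, vorticityKernel, ← hy0, dirichletHeat, Fin.sum_univ_two]
  set A : ℝ → ℝ := fun b => (halfFourier t 0 ((x.1 - y.1 : ℝ) + b * Complex.I)).re with hA
  set C : ℝ → ℝ := fun b => (halfFourier t 1 ((x.1 - y.1 : ℝ) + b * Complex.I)).re with hC
  have hAd : ∀ b, HasDerivAt A (-C b) b := fun b => by
    have := hasDerivAt_re (hasDerivAt_halfFourier_im ht 0 (x.1 - y.1) b)
    rwa [Complex.neg_re] at this
  have hAc : Continuous A := continuous_iff_continuousAt.2 fun b => (hAd b).continuousAt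
  have hCc : Continuous C := by
    have := continuous_halfFourier ht 1
    exact Complex.continuous_re.comp (this.comp (by fun_prop))
  have hgc := continuous_gauss t
  have hgc' := continuous_gaussDeriv t
  have hp : ∀ s, HasDerivAt (fun s => gauss t (x.2 - s)) (-gaussDeriv t (x.2 - s)) s :=
    fun s => by simpa using (hasDerivAt_gauss ht (x.2 - s)).comp_const_sub x.2 s
  have hm : ∀ s, HasDerivAt (fun s => gauss t (x.2 + s)) (gaussDeriv t (x.2 + s)) s :=
    fun s => (hasDerivAt_gauss ht (x.2 + s)).comp_const_add x.2 s
  have hA1 : ∀ s, HasDerivAt (fun s => A (y.2 - s)) (C (y.2 - s)) s :=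
    fun s => by simpa using (hAd (y.2 - s)).comp_const_sub y.2 s
  have hA2 : ∀ s, HasDerivAt (fun s => A (s + y.2)) (-C (s + y.2)) s :=
    fun s => (hAd (s + y.2)).comp_add_const s y.2
  have hA3 : ∀ s, HasDerivAt (fun s => A (s - y.2)) (-C (s - y.2)) s :=
    fun s => (hAd (s - y.2)).comp_sub_const s y.2
  set J : ℝ → ℝ := fun z₂ => ∫ z₁ : ℝ, ∑ j, curlKernel t j x (z₁, z₂) * velKernel (z₁, z₂) y j
    with hJ
  rw [IntegrableOn, volume_restrict_halfPlane] at hint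
  have hJi : IntegrableOn J (Set.Ioi 0) := hint.integral_prod_right
  rw [volume_restrict_halfPlane, integral_prod_symm _ hint]
  change ∫ z₂ in Set.Ioi (0 : ℝ), J z₂ = _
  -- the primitive below the height of `y`
  set Φ : ℝ → ℝ := fun s => (gauss t (x.2 - s) + gauss t (x.2 + s)) *
    (1 / 2 * (A (y.2 - s) + A (s + y.2))) - 2 * (gauss t (x.2 + s) * A (y.2 - s)) with hΦ
  -- the primitive above the height of `y`
  set Ψ : ℝ → ℝ := fun s => (gauss t (x.2 - s) + gauss t (x.2 + s)) *
    (1 / 2 * (A (s + y.2) - A (s - y.2))) with hΨ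
  set R : ℝ → ℝ := fun s => gaussDeriv t (x.2 + s) * A (y.2 - s) with hR
  have hlow : ∀ s ∈ Set.Ioo 0 y.2, HasDerivAt Φ (J s - 2 * R s) s := by
    intro s hs
    have hJs : J s = _ := integral_curlKernel_mul_velKernel_line ht x y (ε := -1) (b := y.2 - s)
      (z₂ := s) (Or.inr rfl) (by linarith [hs.2]) (by ring) (by linarith [hs.1])
    have h := (((hp s).add (hm s)).mul (((hA1 s).add (hA2 s)).const_mul (1 / 2))).sub
      (((hm s).mul (hA1 s)).const_mul 2)
    refine h.congr_deriv ?_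
    rw [hJs]
    simp only [hR, hA, hC, Pi.add_apply]
    ring
  have hhigh : ∀ s ∈ Set.Ioi y.2, HasDerivAt Ψ (J s) s := by
    intro s hs
    have hs : y.2 < s := hs
    have hJs : J s = _ := integral_curlKernel_mul_velKernel_line ht x y (ε := 1) (b := s - y.2)
      (z₂ := s) (Or.inl rfl) (by linarith) (by ring) (by linarith)
    have h := ((hp s).add (hm s)).mul (((hA2 s).sub (hA3 s)).const_mul (1 / 2))
    refine h.congr_deriv ?_
    rw [hJs]
    simp only [hA, hC, Pi.add_apply, Pi.sub_apply]
    ring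
  have hΦc : Continuous Φ := by fun_prop
  have hΨc : Continuous Ψ := by fun_prop
  have hRc : Continuous R := by fun_prop
  have hJ1 : IntervalIntegrable J volume 0 y.2 :=
    (intervalIntegrable_iff_integrableOn_Ioc_of_le hy.le).2
      (hJi.mono_set Set.Ioc_subset_Ioi_self)
  have hJ2 : IntegrableOn J (Set.Ioi y.2) := hJi.mono_set (Set.Ioi_subset_Ioi hy.le)
  have hRi : IntervalIntegrable (fun s => 2 * R s) volume 0 y.2 :=
    (hRc.const_mul 2).intervalIntegrable _ _
  have hI1 := intervalIntegral.integral_eq_sub_of_hasDerivAt_of_le hy.le hΦc.continuousOn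
    hlow (hJ1.sub hRi)
  rw [intervalIntegral.integral_sub hJ1 hRi, intervalIntegral.integral_const_mul] at hI1
  have hlim : Tendsto Ψ atTop (𝓝 0) := by
    have hb : ∀ b, 0 ≤ b → |A b| ≤ halfMoment t 0 := fun b hb =>
      (Complex.abs_re_le_norm _).trans (norm_halfFourier_le ht 0 (by simpa using hb))
    have hg1 : Tendsto (fun s => gauss t (x.2 - s)) atTop (𝓝 0) := by
      have := (tendsto_gauss_atTop ht).comp (tendsto_atTop_add_const_right atTop (-x.2) tendsto_id)
      refine this.congr fun s => ?_
      simp only [Function.comp, id]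
      rw [← gauss_neg]; congr 1; ring
    have hg2 : Tendsto (fun s => gauss t (x.2 + s)) atTop (𝓝 0) :=
      (tendsto_gauss_atTop ht).comp (tendsto_atTop_add_const_left atTop x.2 tendsto_id)
    have hg := (hg1.add hg2).mul_const (halfMoment t 0)
    rw [add_zero, zero_mul] at hg
    refine squeeze_zero_norm' ?_ hg
    filter_upwards [eventually_ge_atTop y.2] with s hs
    rw [norm_mul, Real.norm_of_nonneg (add_nonneg (gauss_nonneg _ _) (gauss_nonneg _ _))]
    refine mul_le_mul_of_nonneg_left ?_ (add_nonneg (gauss_nonneg _ _) (gauss_nonneg _ _))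
    rw [Real.norm_eq_abs, abs_mul, abs_of_pos (by norm_num : (0 : ℝ) < 1 / 2)]
    have h1 := hb (s + y.2) (by linarith)
    have h2 := hb (s - y.2) (by linarith)
    have := abs_sub (A (s + y.2)) (A (s - y.2))
    linarith
  have hI2 := integral_Ioi_of_hasDerivAt_of_tendsto hΨc.continuousWithinAt hhigh hJ2 hlim
  have hsplit : ∫ s in Set.Ioi (0 : ℝ), J s
      = (∫ s in (0 : ℝ)..y.2, J s) + ∫ s in Set.Ioi y.2, J s := by
    rw [intervalIntegral.integral_of_le hy.le, ← setIntegral_union Set.Ioc_disjoint_Ioi_same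
      measurableSet_Ioi (hJi.mono_set Set.Ioc_subset_Ioi_self) hJ2,
      Set.Ioc_union_Ioi_eq_Ioi hy.le]
  have hA0 : A 0 = gauss t (x.1 - y.1) := by
    simp only [hA, Complex.ofReal_zero, zero_mul, add_zero]
    exact re_halfFourier_zero ht _
  have hW : vorticityKernel t x y = dirichletHeat t x y + 2 * ∫ s in (0 : ℝ)..y.2, R s := rfl
  rw [hsplit, hI2, hW, dirichletHeat, ← hA0]
  simp only [hΦ, hΨ, sub_self, zero_sub, sub_zero, add_zero, zero_add] at hI1 ⊢
  linear_combination hI1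

end

/-! ### Bounds of the vorticity kernel -/

section
variable {t : ℝ}

lemma continuous_vorticityKernel (ht : 0 < t) :
    Continuous fun p : (ℝ × ℝ) × (ℝ × ℝ) => vorticityKernel t p.1 p.2 := by
  have h1 := continuous_gauss t
  have h2 := continuous_gaussDeriv t
  have h3 : Continuous fun q : ((ℝ × ℝ) × (ℝ × ℝ)) × ℝ => (halfFourier t 0
      ((q.1.1.1 - q.1.2.1 : ℝ) + (q.1.2.2 - q.2 : ℝ) * Complex.I)).re :=
    Complex.continuous_re.comp ((continuous_halfFourier ht 0).comp (by fun_prop))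
  unfold vorticityKernel dirichletHeat
  refine Continuous.add (by fun_prop) (Continuous.const_mul ?_ 2)
  refine intervalIntegral.continuous_parametric_intervalIntegral_of_continuous ?_ (by fun_prop)
  simp only [Function.uncurry_def]
  exact Continuous.mul (by fun_prop) h3

lemma inv_sqrt_four_pi_mul_le (ht : 0 < t) : (√(4 * Real.pi * t))⁻¹ ≤ (√t)⁻¹ := by
  have := Real.sqrt_pos.2 ht
  gcongr
  nlinarith [Real.pi_gt_three]

lemma abs_re_halfFourier_zero_le (ht : 0 < t) (a : ℝ) {b : ℝ} (hb : 0 < b) :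
    |(halfFourier t 0 (a + b * Complex.I)).re| ≤ (√t)⁻¹ := by
  obtain ⟨hi, he⟩ := integral_gauss_mul_poisson ht a hb
  rw [← he]
  calc |∫ s, gauss t (a - s) * poisson b s| ≤ ∫ s, (√t)⁻¹ * poisson b s := by
        rw [← Real.norm_eq_abs]
        refine norm_integral_le_of_norm_le ((integrable_poisson hb).const_mul _)
          (ae_of_all _ fun s => ?_)
        rw [Real.norm_of_nonneg (mul_nonneg (gauss_nonneg _ _) (poisson_nonneg hb.le _))]
        exact mul_le_mul_of_nonneg_right ((gauss_le ht _).trans (inv_sqrt_four_pi_mul_le ht))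
          (poisson_nonneg hb.le _)
    _ = (√t)⁻¹ := by rw [integral_const_mul, integral_poisson hb, mul_one]

lemma gaussDeriv_nonpos (ht : 0 < t) {s : ℝ} (hs : 0 ≤ s) : gaussDeriv t s ≤ 0 := by
  rw [gaussDeriv, neg_mul, neg_nonpos]
  exact mul_nonneg (by positivity) (gauss_nonneg t s)

lemma abs_gauss_sub_le (ht : 0 < t) (r s : ℝ) :
    |gauss t r - gauss t s| ≤ (√t)⁻¹ ∧ |gauss t r - gauss t s| ≤ |r - s| / t := by
  constructor
  · have h1 := (gauss_le ht r).trans (inv_sqrt_four_pi_mul_le ht)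
    have h2 := (gauss_le ht s).trans (inv_sqrt_four_pi_mul_le ht)
    rw [abs_le]
    constructor <;> linarith [gauss_nonneg t r, gauss_nonneg t s]
  · have h := Convex.norm_image_sub_le_of_norm_hasDerivWithin_le (f := gauss t)
      (f' := gaussDeriv t) (C := 1 / t) (s := Set.univ) (x := s) (y := r)
      (fun x _ => (hasDerivAt_gauss ht x).hasDerivWithinAt) (fun x _ => abs_gaussDeriv_le ht x)
      convex_univ trivial trivial
    rw [Real.norm_eq_abs, Real.norm_eq_abs] at h
    rwa [one_div_mul_eq_div] at h

/-- The factor `min(1, y₂ / √t)` by which mass near the boundary is cancelled at time `t`. -/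
noncomputable def decayFactor (t : ℝ) (y : ℝ × ℝ) : ℝ := min 1 (y.2 / √t)

lemma inv_sqrt_mul_le {r : ℝ} (ht : 0 < t) {y : ℝ × ℝ} (h1 : r ≤ (√t)⁻¹) (h2 : r ≤ y.2 / t) :
    (√t)⁻¹ * r ≤ decayFactor t y / t := by
  have hs := Real.sqrt_pos.2 ht
  have hst : √t * √t = t := Real.mul_self_sqrt ht.le
  rw [le_div_iff₀ ht, decayFactor, le_min_iff]
  constructor
  · calc (√t)⁻¹ * r * t ≤ (√t)⁻¹ * (√t)⁻¹ * t := by gcongr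
      _ = 1 := by rw [← mul_inv, hst, inv_mul_cancel₀ ht.ne']
  · calc (√t)⁻¹ * r * t ≤ (√t)⁻¹ * (y.2 / t) * t := by gcongr
      _ = y.2 / √t := by field_simp

lemma abs_vorticityKernel_le (ht : 0 < t) {x y : ℝ × ℝ} (hx : 0 ≤ x.2) (hy : 0 ≤ y.2) :
    |vorticityKernel t x y| ≤ 4 * decayFactor t y / t := by
  have hs := Real.sqrt_pos.2 ht
  have hd : |dirichletHeat t x y| ≤ 2 * (decayFactor t y / t) := by
    obtain ⟨h1, h2⟩ := abs_gauss_sub_le ht (x.2 - y.2) (x.2 + y.2)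
    have e : |x.2 - y.2 - (x.2 + y.2)| = 2 * y.2 := by
      rw [show x.2 - y.2 - (x.2 + y.2) = -(2 * y.2) by ring, abs_neg, abs_of_nonneg (by positivity)]
    rw [e] at h2
    set r := |gauss t (x.2 - y.2) - gauss t (x.2 + y.2)| with hr
    have hr0 : 0 ≤ r := abs_nonneg _
    have h := inv_sqrt_mul_le ht (r := r / 2) (y := y) (by linarith)
      (by linarith [show 2 * y.2 / t = 2 * (y.2 / t) by ring])
    rw [dirichletHeat, abs_mul, abs_of_nonneg (gauss_nonneg _ _)]
    have h3 := (gauss_le ht (x.1 - y.1)).trans (inv_sqrt_four_pi_mul_le ht)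
    have h4 := mul_le_mul_of_nonneg_right h3 hr0
    linarith
  have hI : |∫ s in (0 : ℝ)..y.2, gaussDeriv t (x.2 + s)
      * (halfFourier t 0 ((x.1 - y.1 : ℝ) + (y.2 - s : ℝ) * Complex.I)).re|
      ≤ decayFactor t y / t := by
    have hc : IntervalIntegrable (fun s => gaussDeriv t (x.2 + s)) volume 0 y.2 := by
      have := continuous_gaussDeriv t
      exact Continuous.intervalIntegrable (by fun_prop) _ _
    have hb : |∫ s in (0 : ℝ)..y.2, gaussDeriv t (x.2 + s)
        * (halfFourier t 0 ((x.1 - y.1 : ℝ) + (y.2 - s : ℝ) * Complex.I)).re|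
        ≤ ∫ s in (0 : ℝ)..y.2, (√t)⁻¹ * -gaussDeriv t (x.2 + s) := by
      rw [← Real.norm_eq_abs]
      refine intervalIntegral.norm_integral_le_of_norm_le hy ?_ (hc.neg.const_mul _)
      have hne : ∀ᵐ s : ℝ, s ≠ y.2 := by simp [ae_iff]
      filter_upwards [hne] with s hs hsm
      have hb : 0 < y.2 - s := sub_pos.2 (lt_of_le_of_ne hsm.2 hs)
      rw [norm_mul, Real.norm_of_nonpos (gaussDeriv_nonpos ht (add_nonneg hx hsm.1.le)), mul_comm]
      exact mul_le_mul_of_nonneg_right (abs_re_halfFourier_zero_le ht _ hb)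
        (neg_nonneg.2 (gaussDeriv_nonpos ht (add_nonneg hx hsm.1.le)))
    have hFTC := intervalIntegral.integral_eq_sub_of_hasDerivAt
      (fun s _ => (hasDerivAt_gauss ht (x.2 + s)).comp_const_add x.2 s) hc
    rw [intervalIntegral.integral_const_mul, intervalIntegral.integral_neg, hFTC] at hb
    refine hb.trans ?_
    obtain ⟨h1, h2⟩ := abs_gauss_sub_le ht (x.2 + y.2) (x.2 + 0)
    have e : |x.2 + y.2 - (x.2 + 0)| = y.2 := by
      rw [show x.2 + y.2 - (x.2 + 0) = y.2 by ring, abs_of_nonneg hy]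
    rw [e] at h2
    exact inv_sqrt_mul_le ht ((neg_le_abs _).trans h1) ((neg_le_abs _).trans h2)
  rw [vorticityKernel]
  refine (abs_add_le _ _).trans ?_
  rw [abs_mul 2, abs_two]
  linarith [show 4 * decayFactor t y / t = 4 * (decayFactor t y / t) by ring]

lemma lintegral_gauss (ht : 0 < t) (c : ℝ) :
    ∫⁻ s, ENNReal.ofReal (gauss t (s - c)) = 1 := by
  rw [lintegral_sub_right_eq_self (fun s => ENNReal.ofReal (gauss t s)),
    ← ofReal_integral_eq_lintegral_ofReal (integrable_gauss ht)
      (ae_of_all _ fun s => gauss_nonneg t s), integral_gauss_eq_one ht, ENNReal.ofReal_one]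

/-- The Poisson integral `P_b * Γ₁` has mass at most one. -/
lemma lintegral_re_halfFourier_le (ht : 0 < t) (c : ℝ) {b : ℝ} (hb : 0 < b) :
    ∫⁻ a : ℝ, ‖(halfFourier t 0 ((a - c : ℝ) + b * Complex.I)).re‖ₑ ≤ 1 := by
  have h1 : ∀ a : ℝ, ‖(halfFourier t 0 ((a - c : ℝ) + b * Complex.I)).re‖ₑ
      ≤ ∫⁻ s, ENNReal.ofReal (poisson b s) * ENNReal.ofReal (gauss t (a - (c + s))) := by
    intro a
    rw [← (integral_gauss_mul_poisson ht (a - c) hb).2]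
    refine (enorm_integral_le_lintegral_enorm _).trans (lintegral_mono fun s => ?_)
    rw [Real.enorm_of_nonneg (mul_nonneg (gauss_nonneg _ _) (poisson_nonneg hb.le _)),
      ENNReal.ofReal_mul (gauss_nonneg _ _), mul_comm, sub_add_eq_sub_sub]
  have hm1 : Measurable fun s => ENNReal.ofReal (poisson b s) :=
    (continuous_poisson hb).measurable.ennreal_ofReal
  have hm2 := (continuous_gauss t).measurable
  have hm3 : Measurable fun q : ℝ × ℝ =>
      ENNReal.ofReal (poisson b q.2) * ENNReal.ofReal (gauss t (q.1 - (c + q.2))) :=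
    (hm1.comp measurable_snd).mul (by fun_prop)
  refine (lintegral_mono h1).trans ?_
  rw [lintegral_lintegral_swap hm3.aemeasurable]
  have h2 : ∀ s, ∫⁻ a, ENNReal.ofReal (poisson b s) * ENNReal.ofReal (gauss t (a - (c + s)))
      = ENNReal.ofReal (poisson b s) := by
    intro s
    rw [lintegral_const_mul _ (by fun_prop), lintegral_gauss ht, mul_one]
  simp_rw [h2]
  rw [← ofReal_integral_eq_lintegral_ofReal (integrable_poisson hb)
    (ae_of_all _ fun s => poisson_nonneg hb.le s), integral_poisson hb, ENNReal.ofReal_one]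

lemma lintegral_gaussDeriv (ht : 0 < t) {s : ℝ} (hs : 0 ≤ s) :
    ∫⁻ r in Set.Ioi (0 : ℝ), ‖gaussDeriv t (r + s)‖ₑ = ENNReal.ofReal (gauss t s) := by
  have hi : IntegrableOn (fun r => gaussDeriv t (r + s)) (Set.Ioi 0) :=
    ((integrable_gaussDeriv ht).comp_add_right s).integrableOn
  have h := integral_Ioi_of_hasDerivAt_of_tendsto' (a := 0)
    (fun r _ => (hasDerivAt_gauss ht (r + s)).comp_add_const r s) hi
    ((tendsto_gauss_atTop ht).comp (tendsto_atTop_add_const_right atTop s tendsto_id))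
  have hnn : ∀ᵐ r ∂(volume.restrict (Set.Ioi (0 : ℝ))), 0 ≤ -gaussDeriv t (r + s) := by
    filter_upwards [ae_restrict_mem measurableSet_Ioi] with r hr
    exact neg_nonneg.2 (gaussDeriv_nonpos ht (add_nonneg (le_of_lt hr) hs))
  have e : ∫ r in Set.Ioi (0 : ℝ), -gaussDeriv t (r + s) = gauss t s := by
    rw [integral_neg, h]; simp
  have hi' : IntegrableOn (fun r => -gaussDeriv t (r + s)) (Set.Ioi 0) := hi.neg
  rw [← e, ofReal_integral_eq_lintegral_ofReal hi' hnn]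
  refine lintegral_congr_ae ?_
  filter_upwards [hnn] with r hr
  rw [← Real.enorm_of_nonneg hr, enorm_neg]

lemma integral_gauss_Ioc_le (ht : 0 < t) {y : ℝ × ℝ} (hy : 0 ≤ y.2) :
    ∫ s in Set.Ioc (-y.2) y.2, gauss t s ≤ 2 * decayFactor t y := by
  have h1 : ∫ s in Set.Ioc (-y.2) y.2, gauss t s ≤ 1 := by
    rw [← integral_gauss_eq_one ht]
    exact setIntegral_le_integral (integrable_gauss ht) (ae_of_all _ fun s => gauss_nonneg t s)
  have h2 : ∫ s in Set.Ioc (-y.2) y.2, gauss t s ≤ 2 * (y.2 / √t) := by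
    calc ∫ s in Set.Ioc (-y.2) y.2, gauss t s ≤ ∫ s in Set.Ioc (-y.2) y.2, (√t)⁻¹ := by
          refine setIntegral_mono_on (integrable_gauss ht).integrableOn (by simp) measurableSet_Ioc
            fun s _ => (gauss_le ht s).trans (inv_sqrt_four_pi_mul_le ht)
      _ = 2 * (y.2 / √t) := by
          rw [setIntegral_const, Real.volume_real_Ioc_of_le (by linarith), smul_eq_mul]
          ring
  rw [decayFactor]
  rcases le_total 1 (y.2 / √t) with h | h
  · rw [min_eq_left h]; linarith
  · rw [min_eq_right h]; exact h2

lemma setIntegral_Ioi_comp_add_right (f : ℝ → ℝ) (a c : ℝ) :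
    ∫ s in Set.Ioi a, f (s + c) = ∫ s in Set.Ioi (a + c), f s := by
  have h := (measurePreserving_add_right volume c).setIntegral_preimage_emb
    (measurableEmbedding_addRight c) f (Set.Ioi (a + c))
  rwa [Set.preimage_add_const_Ioi, add_sub_cancel_right] at h

lemma lintegral_dirichletHeat_le (ht : 0 < t) {y : ℝ × ℝ} (hy : 0 ≤ y.2) :
    ∫⁻ x in halfPlane, ‖dirichletHeat t x y‖ₑ ≤ ENNReal.ofReal (2 * decayFactor t y) := by
  have hgm := (continuous_gauss t).measurable
  have e : ∀ x : ℝ × ℝ, ‖dirichletHeat t x y‖ₑ = ENNReal.ofReal (gauss t (x.1 - y.1))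
      * ‖gauss t (x.2 - y.2) - gauss t (x.2 + y.2)‖ₑ := by
    intro x
    rw [dirichletHeat, enorm_mul, Real.enorm_of_nonneg (gauss_nonneg _ _)]
  simp_rw [e]
  rw [volume_restrict_halfPlane, lintegral_prod_mul
    (f := fun a => ENNReal.ofReal (gauss t (a - y.1)))
    (g := fun b => ‖gauss t (b - y.2) - gauss t (b + y.2)‖ₑ) (by fun_prop) (by fun_prop),
    lintegral_gauss ht, one_mul]
  have i1 : IntegrableOn (fun b => gauss t (b - y.2)) (Set.Ioi 0) :=
    ((integrable_gauss ht).comp_sub_right y.2).integrableOn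
  have i2 : IntegrableOn (fun b => gauss t (b + y.2)) (Set.Ioi 0) :=
    ((integrable_gauss ht).comp_add_right y.2).integrableOn
  have hnn : ∀ᵐ b ∂(volume.restrict (Set.Ioi (0 : ℝ))),
      0 ≤ gauss t (b - y.2) - gauss t (b + y.2) := by
    filter_upwards [ae_restrict_mem measurableSet_Ioi] with b hb
    have hb : 0 < b := hb
    refine sub_nonneg.2 (gauss_le_gauss ht ?_)
    rw [abs_of_nonneg (add_nonneg hb.le hy), abs_le]
    constructor <;> linarith
  have e1 : ∫ b in Set.Ioi (0 : ℝ), gauss t (b - y.2) = ∫ b in Set.Ioi (-y.2), gauss t b := by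
    simpa [sub_eq_add_neg] using setIntegral_Ioi_comp_add_right (gauss t) 0 (-y.2)
  have e2 : ∫ b in Set.Ioi (0 : ℝ), gauss t (b + y.2) = ∫ b in Set.Ioi y.2, gauss t b := by
    simpa using setIntegral_Ioi_comp_add_right (gauss t) 0 y.2
  have e3 : ∫ b in Set.Ioi (0 : ℝ), (gauss t (b - y.2) - gauss t (b + y.2))
      = ∫ s in Set.Ioc (-y.2) y.2, gauss t s := by
    rw [integral_sub i1 i2, e1, e2, sub_eq_iff_eq_add,
      ← setIntegral_union Set.Ioc_disjoint_Ioi_same measurableSet_Ioi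
      (integrable_gauss ht).integrableOn (integrable_gauss ht).integrableOn,
      Set.Ioc_union_Ioi_eq_Ioi (by linarith)]
  have i12 : IntegrableOn (fun b => gauss t (b - y.2) - gauss t (b + y.2)) (Set.Ioi 0) :=
    i1.sub i2
  have e4 : ∫⁻ b in Set.Ioi (0 : ℝ), ‖gauss t (b - y.2) - gauss t (b + y.2)‖ₑ
      = ∫⁻ b in Set.Ioi (0 : ℝ), ENNReal.ofReal (gauss t (b - y.2) - gauss t (b + y.2)) := by
    refine lintegral_congr_ae ?_
    filter_upwards [hnn] with b hb
    rw [Real.enorm_of_nonneg hb]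
  rw [e4, ← ofReal_integral_eq_lintegral_ofReal i12 hnn, e3]
  exact ENNReal.ofReal_le_ofReal (integral_gauss_Ioc_le ht hy)

lemma lintegral_vorticityKernel_snd_le (ht : 0 < t) {y : ℝ × ℝ} (hy : 0 ≤ y.2) :
    ∫⁻ x in halfPlane, ‖∫ s in (0 : ℝ)..y.2, gaussDeriv t (x.2 + s)
      * (halfFourier t 0 ((x.1 - y.1 : ℝ) + (y.2 - s : ℝ) * Complex.I)).re‖ₑ
      ≤ ENNReal.ofReal (2 * decayFactor t y) := by
  have hgc := continuous_gaussDeriv t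
  have hFc : Continuous fun q : (ℝ × ℝ) × ℝ => (halfFourier t 0
      ((q.1.1 - y.1 : ℝ) + (y.2 - q.2 : ℝ) * Complex.I)).re :=
    Complex.continuous_re.comp ((continuous_halfFourier ht 0).comp (by fun_prop))
  have h1 : ∀ x : ℝ × ℝ, ‖∫ s in (0 : ℝ)..y.2, gaussDeriv t (x.2 + s)
      * (halfFourier t 0 ((x.1 - y.1 : ℝ) + (y.2 - s : ℝ) * Complex.I)).re‖ₑ
      ≤ ∫⁻ s in Set.Ioc 0 y.2, ‖gaussDeriv t (x.2 + s)‖ₑ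
        * ‖(halfFourier t 0 ((x.1 - y.1 : ℝ) + (y.2 - s : ℝ) * Complex.I)).re‖ₑ := by
    intro x
    rw [intervalIntegral.integral_of_le hy]
    refine (enorm_integral_le_lintegral_enorm _).trans (lintegral_mono fun s => ?_)
    rw [enorm_mul]
  refine (lintegral_mono h1).trans ?_
  have hmeas : Measurable fun q : (ℝ × ℝ) × ℝ => ‖gaussDeriv t (q.1.2 + q.2)‖ₑ
      * ‖(halfFourier t 0 ((q.1.1 - y.1 : ℝ) + (y.2 - q.2 : ℝ) * Complex.I)).re‖ₑ :=
    (Continuous.measurable (by fun_prop)).enorm.mul hFc.measurable.enorm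
  rw [lintegral_lintegral_swap hmeas.aemeasurable]
  have h2 : ∀ᵐ s ∂(volume.restrict (Set.Ioc 0 y.2)),
      ∫⁻ x in halfPlane, ‖gaussDeriv t (x.2 + s)‖ₑ
        * ‖(halfFourier t 0 ((x.1 - y.1 : ℝ) + (y.2 - s : ℝ) * Complex.I)).re‖ₑ
      ≤ ENNReal.ofReal (gauss t s) := by
    have hne : ∀ᵐ s : ℝ, s ≠ y.2 := by simp [ae_iff]
    filter_upwards [ae_restrict_of_ae hne, ae_restrict_mem measurableSet_Ioc] with s hs hsm
    have hb : 0 < y.2 - s := sub_pos.2 (lt_of_le_of_ne hsm.2 hs)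
    have hFm : Measurable fun a : ℝ =>
        ‖(halfFourier t 0 ((a - y.1 : ℝ) + (y.2 - s : ℝ) * Complex.I)).re‖ₑ :=
      ((hFc.comp (g := fun q : (ℝ × ℝ) × ℝ => (halfFourier t 0
        ((q.1.1 - y.1 : ℝ) + (y.2 - q.2 : ℝ) * Complex.I)).re)
        (f := fun a : ℝ => (((a, 0) : ℝ × ℝ), s)) (by fun_prop)).measurable).enorm
    have hGm : Measurable fun r : ℝ => ‖gaussDeriv t (r + s)‖ₑ :=
      (Continuous.measurable (by fun_prop)).enorm
    simp_rw [mul_comm ‖gaussDeriv t _‖ₑ]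
    rw [volume_restrict_halfPlane, lintegral_prod_mul hFm.aemeasurable hGm.aemeasurable,
      lintegral_gaussDeriv ht hsm.1.le]
    exact mul_le_of_le_one_left' (lintegral_re_halfFourier_le ht _ hb)
  refine (lintegral_mono_ae h2).trans ?_
  rw [← ofReal_integral_eq_lintegral_ofReal (integrable_gauss ht).integrableOn
    (ae_of_all _ fun s => gauss_nonneg t s)]
  refine ENNReal.ofReal_le_ofReal (le_trans ?_ (integral_gauss_Ioc_le ht hy))
  exact setIntegral_mono_set (integrable_gauss ht).integrableOn
    (ae_of_all _ fun s => gauss_nonneg t s)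
    (Set.Ioc_subset_Ioc_left (by linarith)).eventuallyLE

lemma lintegral_vorticityKernel_le (ht : 0 < t) {y : ℝ × ℝ} (hy : 0 ≤ y.2) :
    ∫⁻ x in halfPlane, ‖vorticityKernel t x y‖ₑ ≤ ENNReal.ofReal (6 * decayFactor t y) := by
  have hd : 0 ≤ decayFactor t y := le_min zero_le_one (by positivity)
  have hm : Measurable fun x => ‖dirichletHeat t x y‖ₑ := by
    have := (continuous_gauss t).measurable
    unfold dirichletHeat; fun_prop
  calc ∫⁻ x in halfPlane, ‖vorticityKernel t x y‖ₑ
      ≤ ∫⁻ x in halfPlane, (‖dirichletHeat t x y‖ₑ + 2 * ‖∫ s in (0 : ℝ)..y.2,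
        gaussDeriv t (x.2 + s)
          * (halfFourier t 0 ((x.1 - y.1 : ℝ) + (y.2 - s : ℝ) * Complex.I)).re‖ₑ) := by
        refine lintegral_mono fun x => (enorm_add_le _ _).trans_eq ?_
        rw [enorm_mul, Real.enorm_of_nonneg zero_le_two, ENNReal.ofReal_ofNat]
    _ ≤ ENNReal.ofReal (2 * decayFactor t y) + 2 * ENNReal.ofReal (2 * decayFactor t y) := by
        rw [lintegral_add_left hm, lintegral_const_mul' _ _ ENNReal.ofNat_ne_top]
        exact add_le_add (lintegral_dirichletHeat_le ht hy)
          (mul_le_mul_right (lintegral_vorticityKernel_snd_le ht hy) _)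
    _ = ENNReal.ofReal (6 * decayFactor t y) := by
        rw [← ENNReal.ofReal_ofNat 2, ← ENNReal.ofReal_mul (by norm_num),
          ← ENNReal.ofReal_add (by positivity) (by positivity)]
        congr 1; ring

end

/-! ### Decay of the vorticity of a finite positive measure -/

/-- Interpolation between the bounds `L` and `B` of the `L¹` and `L^∞` norms, in the form in which
both are controlled by `N` at the scale `τ`. -/
lemma mul_eLpNorm_le_of_bounds {α : Type*} [MeasurableSpace α] {μ : Measure α} {f : α → ℝ}
    {N τ : ℝ≥0∞} (hf : AEStronglyMeasurable f μ) (hτ0 : τ ≠ 0) (hτ : τ ≠ ∞) (h1 : ∫⁻ x, ‖f x‖ₑ ∂μ ≤ N)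
    (hinf : ∀ᵐ x ∂μ, ‖f x‖ₑ ≤ N / τ) {q : ℝ≥0∞} (hq : 1 ≤ q) :
    τ ^ (1 - 1 / q.toReal) * eLpNorm f q μ ≤ N := by
  rcases eq_or_ne q ∞ with rfl | hq'
  · simp only [ENNReal.toReal_top, div_zero, sub_zero, ENNReal.rpow_one, eLpNorm_exponent_top]
    calc τ * eLpNormEssSup f μ ≤ τ * (N / τ) := by
          gcongr
          exact essSup_le_of_ae_le _ hinf
      _ ≤ N := ENNReal.mul_div_le
  have hr : 1 ≤ q.toReal := by
    rw [← ENNReal.toReal_one]; exact ENNReal.toReal_mono hq' hq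
  have hq0 : q ≠ 0 := (zero_lt_one.trans_le hq).ne'
  set r := q.toReal with hrdef
  have hr0 : 0 < r := by linarith
  have he : 0 ≤ 1 - 1 / r := by
    rw [sub_nonneg, div_le_one hr0]; exact hr
  have hint : ∫⁻ x, ‖f x‖ₑ ^ r ∂μ ≤ (N / τ) ^ (r - 1) * N := by
    calc ∫⁻ x, ‖f x‖ₑ ^ r ∂μ ≤ ∫⁻ x, (N / τ) ^ (r - 1) * ‖f x‖ₑ ∂μ := by
          refine lintegral_mono_ae ?_
          filter_upwards [hinf] with x hx
          calc ‖f x‖ₑ ^ r = ‖f x‖ₑ ^ (r - 1) * ‖f x‖ₑ ^ (1 : ℝ) := by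
                rw [← ENNReal.rpow_add_of_nonneg _ _ (by linarith) zero_le_one, sub_add_cancel]
            _ ≤ (N / τ) ^ (r - 1) * ‖f x‖ₑ := by
                rw [ENNReal.rpow_one]
                gcongr
      _ ≤ (N / τ) ^ (r - 1) * ∫⁻ x, ‖f x‖ₑ ∂μ :=
          (lintegral_const_mul'' _ hf.enorm).le
      _ ≤ _ := by gcongr
  rw [eLpNorm_eq_lintegral_rpow_enorm_toReal hq0 hq']
  calc τ ^ (1 - 1 / r) * (∫⁻ x, ‖f x‖ₑ ^ r ∂μ) ^ (1 / r)
      ≤ τ ^ (1 - 1 / r) * ((N / τ) ^ (r - 1) * N) ^ (1 / r) := by gcongr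
    _ = (τ * (N / τ)) ^ (1 - 1 / r) * N ^ (1 / r) := by
        rw [ENNReal.mul_rpow_of_nonneg _ _ (by positivity : 0 ≤ 1 / r), ← ENNReal.rpow_mul,
          ENNReal.mul_rpow_of_nonneg _ _ he, mul_assoc]
        congr 3
        field_simp
    _ = N ^ (1 - 1 / r) * N ^ (1 / r) := by rw [ENNReal.mul_div_cancel hτ0 hτ]
    _ = N := by
        rw [← ENNReal.rpow_add_of_nonneg _ _ he (by positivity), sub_add_cancel, ENNReal.rpow_one]

section
variable (ν : Measure closedHalfPlane) {t : ℝ}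

/-- The vorticity at time `t` issuing from a finite positive measure. -/
noncomputable def measureVorticity (t : ℝ) (x : ℝ × ℝ) : ℝ := ∫ y, vorticityKernel t x y ∂ν

/-- The part of the mass of `ν` that is not yet cancelled at time `t`, up to a constant. -/
noncomputable def decayMass (t : ℝ) : ℝ≥0∞ :=
  ∫⁻ y : closedHalfPlane, ENNReal.ofReal (6 * decayFactor t y) ∂ν

lemma measurable_vorticityKernel (ht : 0 < t) :
    Measurable fun p : (ℝ × ℝ) × closedHalfPlane => vorticityKernel t p.1 p.2 :=
  Measurable.comp (g := fun p : (ℝ × ℝ) × (ℝ × ℝ) => vorticityKernel t p.1 p.2)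
    (f := fun p : (ℝ × ℝ) × closedHalfPlane => (p.1, (p.2 : ℝ × ℝ)))
    (continuous_vorticityKernel ht).measurable
    (measurable_fst.prodMk (measurable_subtype_coe.comp measurable_snd))

lemma stronglyMeasurable_measureVorticity [IsFiniteMeasure ν] (ht : 0 < t) :
    StronglyMeasurable (measureVorticity ν t) :=
  (measurable_vorticityKernel ht).stronglyMeasurable.integral_prod_right'

lemma measurable_decayFactor (t : ℝ) :
    Measurable fun y : closedHalfPlane => ENNReal.ofReal (6 * decayFactor t y) := by
  unfold decayFactor
  fun_prop

lemma decayFactor_le_one (t : ℝ) (y : ℝ × ℝ) : decayFactor t y ≤ 1 := min_le_left _ _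

lemma decayMass_ne_top [IsFiniteMeasure ν] (t : ℝ) : decayMass ν t ≠ ∞ := by
  refine ((lintegral_mono (g := fun _ => ENNReal.ofReal 6) fun y => ?_).trans_lt ?_).ne
  · exact ENNReal.ofReal_le_ofReal (by linarith [decayFactor_le_one t y])
  · rw [lintegral_const]
    exact ENNReal.mul_lt_top ENNReal.ofReal_lt_top (measure_lt_top _ _)

lemma tendsto_decayMass [IsFiniteMeasure ν] : Tendsto (decayMass ν) atTop (𝓝 0) := by
  have h : Tendsto (decayMass ν) atTop (𝓝 (∫⁻ _ : closedHalfPlane, 0 ∂ν)) := by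
    refine tendsto_lintegral_filter_of_dominated_convergence (fun _ => ENNReal.ofReal 6)
      (Eventually.of_forall fun t => measurable_decayFactor t)
      (Eventually.of_forall fun t => ae_of_all _ fun y => ?_) ?_ (ae_of_all _ fun y => ?_)
    · exact ENNReal.ofReal_le_ofReal (by linarith [decayFactor_le_one t y])
    · rw [lintegral_const]
      exact (ENNReal.mul_lt_top ENNReal.ofReal_lt_top (measure_lt_top _ _)).ne
    · have h1 : Tendsto (fun t : ℝ => (y : ℝ × ℝ).2 / √t) atTop (𝓝 0) :=
        Tendsto.div_atTop tendsto_const_nhds Real.tendsto_sqrt_atTop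
      have h2 := (((tendsto_const_nhds (x := (1 : ℝ))).min h1).const_mul 6)
      rw [min_eq_right zero_le_one, mul_zero] at h2
      simpa only [ENNReal.ofReal_zero, decayFactor] using ENNReal.tendsto_ofReal h2
  simpa using h

lemma enorm_measureVorticity_le (ht : 0 < t) {x : ℝ × ℝ} (hx : 0 ≤ x.2) :
    ‖measureVorticity ν t x‖ₑ ≤ decayMass ν t / ENNReal.ofReal t := by
  refine (enorm_integral_le_lintegral_enorm _).trans ?_
  rw [decayMass, div_eq_mul_inv, ← lintegral_mul_const _ (measurable_decayFactor t)]
  refine lintegral_mono fun y => ?_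
  have hy : 0 ≤ (y : ℝ × ℝ).2 := y.2
  have hd : 0 ≤ decayFactor t y := le_min zero_le_one (by positivity)
  rw [← div_eq_mul_inv, ← ENNReal.ofReal_div_of_pos ht, Real.enorm_eq_ofReal_abs]
  refine ENNReal.ofReal_le_ofReal ((abs_vorticityKernel_le ht hx hy).trans ?_)
  gcongr
  norm_num

lemma lintegral_measureVorticity_le [IsFiniteMeasure ν] (ht : 0 < t) :
    ∫⁻ x in halfPlane, ‖measureVorticity ν t x‖ₑ ≤ decayMass ν t := by
  refine (lintegral_mono fun x => enorm_integral_le_lintegral_enorm _).trans ?_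
  rw [lintegral_lintegral_swap (measurable_vorticityKernel ht).enorm.aemeasurable]
  exact lintegral_mono fun y => lintegral_vorticityKernel_le ht y.2

lemma mul_eLpNorm_measureVorticity_le [IsFiniteMeasure ν] (ht : 0 < t) {q : ℝ≥0∞} (hq : 1 ≤ q) :
    ENNReal.ofReal (t ^ (1 - 1 / q.toReal)) *
      eLpNorm (measureVorticity ν t) q (volume.restrict halfPlane) ≤ decayMass ν t := by
  rw [← ENNReal.ofReal_rpow_of_pos ht]
  refine mul_eLpNorm_le_of_bounds
    (stronglyMeasurable_measureVorticity ν ht).aestronglyMeasurable (by simpa using ht) ENNReal.ofReal_ne_top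
    (lintegral_measureVorticity_le ν ht) ?_ hq
  filter_upwards [ae_restrict_mem measurableSet_halfPlane] with x hx
  exact enorm_measureVorticity_le ν ht (le_of_lt hx)

lemma memLp_measureVorticity [IsFiniteMeasure ν] (ht : 0 < t) {q : ℝ≥0∞} (hq : 1 ≤ q) :
    MemLp (measureVorticity ν t) q (volume.restrict halfPlane) := by
  refine ⟨(stronglyMeasurable_measureVorticity ν ht).aestronglyMeasurable, ?_⟩
  have h := (mul_eLpNorm_measureVorticity_le ν ht hq).trans_lt (decayMass_ne_top ν t).lt_top
  refine ENNReal.lt_top_of_mul_ne_top_right h.ne ?_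
  simpa using Real.rpow_pos_of_pos ht _

end

/-! ### Signed measures -/

section
variable (ω : SignedMeasure closedHalfPlane)

lemma ae_integrable_gradPerp : ∀ᵐ x ∂(volume.restrict halfPlane), ∀ i : Fin 2,
    Integrable (fun y : closedHalfPlane => gradPerp (fun x' => greenD x' y) x i)
      ω.totalVariation := by
  have : IsFiniteMeasure ω.totalVariation := by
    unfold SignedMeasure.totalVariation; infer_instance
  filter_upwards [ae_gradPerp_eq ω.totalVariation, ae_integrable_velKernel ω.totalVariation 0,
    ae_integrable_velKernel ω.totalVariation 1] with x he h0 h1 i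
  have hi : Integrable (fun y : closedHalfPlane => velKernel x y i) ω.totalVariation := by
    rcases Fin.exists_fin_two.1 ⟨i, rfl⟩ with rfl | rfl <;> assumption
  exact hi.congr (he.mono fun y hy => (hy i).symm)

lemma ae_biotSavart_eq : ∀ᵐ z ∂(volume.restrict halfPlane), ∀ i : Fin 2,
    biotSavart ω z i = velocity ω.toJordanDecomposition.posPart z i
      - velocity ω.toJordanDecomposition.negPart z i := by
  filter_upwards [ae_gradPerp_eq ω.toJordanDecomposition.posPart,
    ae_gradPerp_eq ω.toJordanDecomposition.negPart] with z h1 h2 i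
  rw [biotSavart, signedIntegral, velocity, velocity, integral_congr_ae (h1.mono fun y hy => hy i),
    integral_congr_ae (h2.mono fun y hy => hy i)]

lemma integrableOn_weight_mul_biotSavart (i : Fin 2) :
    IntegrableOn (fun z => weight z * biotSavart ω z i) halfPlane := by
  have h := (integrableOn_weight_mul_velocity ω.toJordanDecomposition.posPart i).sub
    (integrableOn_weight_mul_velocity ω.toJordanDecomposition.negPart i)
  refine h.congr ?_
  filter_upwards [ae_biotSavart_eq ω] with z hz
  simp only [Pi.sub_apply, hz i, mul_sub]

/-- The representation of the vorticity by its kernel. -/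
lemma vorticity_eq {t : ℝ} (ht : 0 < t) {x : ℝ × ℝ} (hx : 0 < x.2) :
    vorticity t ω x = measureVorticity ω.toJordanDecomposition.posPart t x
      - measureVorticity ω.toJordanDecomposition.negPart t x := by
  obtain ⟨K, hK, hb⟩ := exists_curlKernel_le ht hx
  have hint : ∀ (ν : Measure closedHalfPlane) [IsFiniteMeasure ν],
      IntegrableOn (fun z => ∑ j, curlKernel t j x z * velocity ν z j) halfPlane := by
    intro ν _
    exact integrable_finsetSum _ fun j _ => integrableOn_mul_of_le_weight
      (integrableOn_weight_mul_velocity ν j) (continuous_curlKernel ht j x) fun z hz => hb z hz j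
  have hval : ∀ (ν : Measure closedHalfPlane) [IsFiniteMeasure ν],
      ∫ z in halfPlane, ∑ j, curlKernel t j x z * velocity ν z j = measureVorticity ν t x := by
    intro ν _
    obtain ⟨h1, h2⟩ := integral_curlKernel_mul_velocity ν ht hx
    rw [h2, measureVorticity]
    exact integral_congr_ae (ae_of_all _ fun y =>
      integral_curlKernel_mul_velKernel ht y.2 (h1 y))
  rw [vorticity, neg_divPerp_stokes ht (integrableOn_weight_mul_biotSavart ω) hx, ← hval, ← hval,
    ← integral_sub (hint _) (hint _)]
  refine integral_congr_ae ?_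
  filter_upwards [ae_biotSavart_eq ω] with z hz
  simp only [hz, Fin.sum_univ_two]
  ring

lemma vorticity_ae_eq {t : ℝ} (ht : 0 < t) :
    vorticity t ω =ᵐ[volume.restrict halfPlane]
      measureVorticity ω.toJordanDecomposition.posPart t
        - measureVorticity ω.toJordanDecomposition.negPart t := by
  filter_upwards [ae_restrict_mem measurableSet_halfPlane] with x hx
  exact vorticity_eq ω ht hx

end

end HalfPlaneStokes

theorem theorem4p7 (ω₀ : SignedMeasure HalfPlaneStokes.closedHalfPlane) :
    -- the Biot-Savart integral converges absolutely almost everywhere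
    (∀ᵐ x ∂(volume.restrict HalfPlaneStokes.halfPlane), ∀ i : Fin 2,
      Integrable (fun y : HalfPlaneStokes.closedHalfPlane =>
        HalfPlaneStokes.gradPerp (fun x' => HalfPlaneStokes.greenD x' y) x i)
        ω₀.totalVariation) ∧
    -- the integral that defines the Stokes flow converges absolutely, and the two partial
    -- derivatives in the vorticity exist classically
    (∀ t : ℝ, 0 < t → ∀ x ∈ HalfPlaneStokes.halfPlane,
      (∀ i j : Fin 2, IntegrableOn
        (fun z => HalfPlaneStokes.stokesGreen i j x z t * HalfPlaneStokes.biotSavart ω₀ z j)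
        HalfPlaneStokes.halfPlane) ∧
      DifferentiableAt ℝ
        (fun s : ℝ => HalfPlaneStokes.stokes t (HalfPlaneStokes.biotSavart ω₀) (x.1, s) 0) x.2 ∧
      DifferentiableAt ℝ
        (fun s : ℝ => HalfPlaneStokes.stokes t (HalfPlaneStokes.biotSavart ω₀) (s, x.2) 1) x.1) ∧
    -- the vorticity belongs to every `L^q` and decays
    (∀ q : ℝ≥0∞, 1 ≤ q →
      (∀ t : ℝ, 0 < t →
        MemLp (HalfPlaneStokes.vorticity t ω₀) q (volume.restrict HalfPlaneStokes.halfPlane)) ∧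
      Tendsto (fun t : ℝ => ENNReal.ofReal (t ^ (1 - 1 / q.toReal)) *
          eLpNorm (HalfPlaneStokes.vorticity t ω₀) q
            (volume.restrict HalfPlaneStokes.halfPlane))
        atTop (𝓝 0)) := by
  have hu := HalfPlaneStokes.integrableOn_weight_mul_biotSavart ω₀
  refine ⟨HalfPlaneStokes.ae_integrable_gradPerp ω₀, fun t ht x hx =>
    ⟨fun i j => HalfPlaneStokes.integrableOn_stokesGreen_mul ht hu hx i j,
      (HalfPlaneStokes.hasDerivAt_stokes_zero ht hu hx).differentiableAt,
      (HalfPlaneStokes.hasDerivAt_stokes_one ht hu hx).differentiableAt⟩, fun q hq => ?_⟩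
  have hpos := fun t (ht : 0 < t) =>
    HalfPlaneStokes.memLp_measureVorticity ω₀.toJordanDecomposition.posPart ht hq
  have hneg := fun t (ht : 0 < t) =>
    HalfPlaneStokes.memLp_measureVorticity ω₀.toJordanDecomposition.negPart ht hq
  refine ⟨fun t ht => ((hpos t ht).sub (hneg t ht)).ae_eq
    (HalfPlaneStokes.vorticity_ae_eq ω₀ ht).symm, ?_⟩
  have hlim := (HalfPlaneStokes.tendsto_decayMass ω₀.toJordanDecomposition.posPart).add
    (HalfPlaneStokes.tendsto_decayMass ω₀.toJordanDecomposition.negPart)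
  rw [add_zero] at hlim
  refine tendsto_of_tendsto_of_tendsto_of_le_of_le' tendsto_const_nhds hlim
    (Eventually.of_forall fun _ => zero_le) ?_
  filter_upwards [eventually_gt_atTop 0] with t ht
  rw [eLpNorm_congr_ae (HalfPlaneStokes.vorticity_ae_eq ω₀ ht)]
  refine (mul_le_mul_right (eLpNorm_sub_le (hpos t ht).1 (hneg t ht).1 hq) _).trans ?_
  rw [mul_add]
  exact add_le_add (HalfPlaneStokes.mul_eLpNorm_measureVorticity_le _ ht hq)
    (HalfPlaneStokes.mul_eLpNorm_measureVorticity_le _ ht hq)
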